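/- Let $S$ and $K$ be nonempty bounded open intervals of $\mathbb{R}$ and let $h>0$. For $y>0$ and $x\in\mathbb{R}$ put $P_y(x)=\frac1\pi\frac{y}{x^2+y^2}$ and $Q_y(x)=\frac1\pi\frac{x}{x^2+y^2}$, and let $\widetilde{u}$ denote the extension by zero to $\mathbb{R}$ of a function $u$ on $S$. Let $b_2\colon L^2(S,\mathbb{R}^2)\to L^2(K)$ be the bounded operator $$b_2[(m_1,m_2)](x)=-\partial_y\big(Q_y\star\widetilde{m_1}+P_y\star\widetilde{m_2}\big)(x)\Big|_{y=h},\qquad x\in K,$$ and let $b_2^*\colon L^2(K)\to L^2(S,\mathbb{R}^2)$ be its Hilbert space adjoint (all spaces are real, and $\langle f,g\rangle_{L^2(S,\mathbb{R}^2)}=\langle f_1,g_1\rangle_{L^2(S)}+\langle f_2,g_2\rangle_{L^2(S)}$). Let $W^{1,2}_0(K)$ be the space of all $\phi\in L^2(K)$ whose distributional derivative $\phi'$ belongs to $L^2(K)$ and whose continuous representative on $\overline{K}$ vanishes at both endpoints of $K$, equipped with the norm $\|\phi\|_{W^{1,2}_0(K)}=\|\phi'\|_{L^2(K)}$. **Proposition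 4.3.** Let $\mathbf{e}\in L^2(S,\mathbb{R}^2)$ and $M\ge 0$. There is exactly one $\phi_o\in W^{1,2}_0(K)$ with $\|\phi_o\|_{W^{1,2}_0(K)}\le M$ such that $$\|b_2^*[\phi_o]-\mathbf{e}\|_{L^2(S,\mathbb{R}^2)}=\min_{\phi\in W^{1,2}_0(K),\ \|\phi\|_{W^{1,2}_0(K)}\le M}\|b_2^*[\phi]-\mathbf{e}\|_{L^2(S,\mathbb{R}^2)}.$$ Moreover, if $\mathbf{e}\notin b_2^*[W^{1,2}_0(K)]$, then $\|\phi_o\|_{W^{1,2}_0(K)}=M$. -/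

import Mathlib

open MeasureTheory Set Filter Topology
open scoped ContDiff

noncomputable section

namespace NetMoment

/-! ### Lebesgue spaces on a bounded open interval -/

/-- The space `L²((a, b))` of real-valued functions. -/
abbrev L2 (a b : ℝ) : Type := Lp ℝ 2 (volume.restrict (Ioo a b))

/-- The space `L²((a, b), ℝ²)`, with inner product `⟨f₁, g₁⟩ + ⟨f₂, g₂⟩`. -/
abbrev L2vec (a b : ℝ) : Type :=
  Lp (EuclideanSpace ℝ (Fin 2)) 2 (volume.restrict (Ioo a b))

/-! ### The Sobolev spaces `W^{1,2}` and `W_0^{1,2}` of a bounded open interval -/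

/-- `g` is the distributional derivative of `f` on `(a, b)`, tested on smooth functions whose
support is a compact subset of `(a, b)`. -/
def IsWeakDeriv {a b : ℝ} (f g : L2 a b) : Prop :=
  ∀ η : ℝ → ℝ, ContDiff ℝ ∞ η → HasCompactSupport η → tsupport η ⊆ Ioo a b →
    ∫ x in Ioo a b, f x * deriv η x = - ∫ x in Ioo a b, g x * η x

theorem integrable_mul_test {a b : ℝ} (f : L2 a b) {η : ℝ → ℝ} (hη : Continuous η)
    (hc : HasCompactSupport η) :
    Integrable (fun x => f x * η x) (volume.restrict (Ioo a b)) := by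
  have h1 : Integrable (fun x => f x) (volume.restrict (Ioo a b)) :=
    (Lp.memLp f).integrable (by norm_num)
  obtain ⟨C, hC⟩ := hc.exists_bound_of_continuous hη
  exact h1.mul_bdd (c := C) hη.aestronglyMeasurable (Eventually.of_forall hC)

theorem IsWeakDeriv.add {a b : ℝ} {f g f' g' : L2 a b} (h : IsWeakDeriv f g)
    (h' : IsWeakDeriv f' g') : IsWeakDeriv (f + f') (g + g') := by
  intro η hη hc hs
  have hd : Continuous (deriv η) := hη.continuous_deriv (by simp)
  have e1 : ∫ x in Ioo a b, (f + f' : L2 a b) x * deriv η x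
      = ∫ x in Ioo a b, (f x * deriv η x + f' x * deriv η x) := by
    refine integral_congr_ae ?_
    filter_upwards [Lp.coeFn_add f f'] with x hx
    rw [hx, Pi.add_apply, add_mul]
  have e2 : ∫ x in Ioo a b, (g + g' : L2 a b) x * η x
      = ∫ x in Ioo a b, (g x * η x + g' x * η x) := by
    refine integral_congr_ae ?_
    filter_upwards [Lp.coeFn_add g g'] with x hx
    rw [hx, Pi.add_apply, add_mul]
  rw [e1, e2, integral_add (integrable_mul_test f hd hc.deriv) (integrable_mul_test f' hd hc.deriv),
    integral_add (integrable_mul_test g hη.continuous hc)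
      (integrable_mul_test g' hη.continuous hc), h η hη hc hs, h' η hη hc hs]
  ring

theorem IsWeakDeriv.smul {a b : ℝ} (r : ℝ) {f g : L2 a b} (h : IsWeakDeriv f g) :
    IsWeakDeriv (r • f) (r • g) := by
  intro η hη hc hs
  have e1 : ∫ x in Ioo a b, (r • f : L2 a b) x * deriv η x
      = ∫ x in Ioo a b, r * (f x * deriv η x) := by
    refine integral_congr_ae ?_
    filter_upwards [Lp.coeFn_smul r f] with x hx
    rw [hx, Pi.smul_apply, smul_eq_mul, mul_assoc]
  have e2 : ∫ x in Ioo a b, (r • g : L2 a b) x * η x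
      = ∫ x in Ioo a b, r * (g x * η x) := by
    refine integral_congr_ae ?_
    filter_upwards [Lp.coeFn_smul r g] with x hx
    rw [hx, Pi.smul_apply, smul_eq_mul, mul_assoc]
  rw [e1, e2, integral_const_mul, integral_const_mul, h η hη hc hs]
  ring

/-- The weak derivative is unique, so that `weakDeriv` below does not depend on a choice. -/
theorem IsWeakDeriv.unique {a b : ℝ} {f g g' : L2 a b} (h : IsWeakDeriv f g)
    (h' : IsWeakDeriv f g') : g = g' := by
  have hg : ∀ u : L2 a b, IntegrableOn (fun x => u x) (Ioo a b) := fun u =>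
    (Lp.memLp u).integrable (by norm_num)
  have key := isOpen_Ioo.ae_eq_zero_of_integral_contDiff_smul_eq_zero (μ := volume)
    (U := Ioo a b) (f := fun x => g x - g' x)
    ((hg g).sub (hg g')).locallyIntegrableOn (by
      intro η hη hc hs
      have hz : ∀ x, x ∉ Ioo a b → η x • (g x - g' x) = 0 := by
        intro x hx
        have : η x = 0 := image_eq_zero_of_notMem_tsupport (fun hx' => hx (hs hx'))
        simp [this]
      rw [← setIntegral_eq_integral_of_forall_compl_eq_zero hz]
      have : ∫ x in Ioo a b, η x • (g x - g' x)
          = ∫ x in Ioo a b, (g x * η x - g' x * η x) := by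
        refine integral_congr_ae (Eventually.of_forall fun x => ?_)
        simp only [smul_eq_mul]
        ring
      rw [this, integral_sub (integrable_mul_test g hη.continuous hc)
        (integrable_mul_test g' hη.continuous hc)]
      have h1 := h η hη hc hs
      have h2 := h' η hη hc hs
      linarith)
  refine Lp.ext ?_
  rw [EventuallyEq, ae_restrict_iff' measurableSet_Ioo]
  filter_upwards [key] with x hx hxU
  linarith [hx hxU]

/-- The Sobolev space `W^{1,2}((a, b))`, as a subspace of `L²((a, b))`. -/
def W12 (a b : ℝ) : Submodule ℝ (L2 a b) where
  carrier := {f | ∃ g : L2 a b, IsWeakDeriv f g}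
  add_mem' := by
    rintro f f' ⟨g, hg⟩ ⟨g', hg'⟩
    exact ⟨g + g', hg.add hg'⟩
  zero_mem' := by
    refine ⟨0, ?_⟩
    intro η hη hc hs
    have e : ∀ u : ℝ → ℝ, ∫ x in Ioo a b, (0 : L2 a b) x * u x = 0 := by
      intro u
      refine integral_eq_zero_of_ae ?_
      filter_upwards [Lp.coeFn_zero ℝ 2 (volume.restrict (Ioo a b))] with x hx
      rw [hx]
      simp
    rw [e, e, neg_zero]
  smul_mem' := by
    rintro r f ⟨g, hg⟩
    exact ⟨r • g, hg.smul r⟩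

/-- The weak derivative `f' ∈ L²((a, b))` of `f ∈ W^{1,2}((a, b))`. -/
def weakDeriv {a b : ℝ} (f : W12 a b) : L2 a b := Classical.choose f.2

theorem weakDeriv_spec {a b : ℝ} (f : W12 a b) : IsWeakDeriv (f : L2 a b) (weakDeriv f) :=
  Classical.choose_spec f.2

/-- The space `W_0^{1,2}((a, b))`: the elements of `W^{1,2}((a, b))` whose representative that is
continuous on `[a, b]` vanishes at both endpoints. -/
def W012 (a b : ℝ) : Submodule ℝ (W12 a b) where
  carrier := {f | ∃ F : ℝ → ℝ, ContinuousOn F (Icc a b) ∧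
    ((f : L2 a b) : ℝ → ℝ) =ᵐ[volume.restrict (Ioo a b)] F ∧ F a = 0 ∧ F b = 0}
  add_mem' := by
    rintro f f' ⟨F, hF, hfF, ha, hb⟩ ⟨F', hF', hfF', ha', hb'⟩
    refine ⟨fun x => F x + F' x, hF.add hF', ?_, by simp [ha, ha'], by simp [hb, hb']⟩
    filter_upwards [Lp.coeFn_add (f : L2 a b) (f' : L2 a b), hfF, hfF'] with x h1 h2 h3
    rw [Submodule.coe_add, h1, Pi.add_apply, h2, h3]
  zero_mem' := by
    refine ⟨fun _ => 0, continuousOn_const, ?_, rfl, rfl⟩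
    filter_upwards [Lp.coeFn_zero ℝ 2 (volume.restrict (Ioo a b))] with x hx
    rw [Submodule.coe_zero, hx]
    rfl
  smul_mem' := by
    rintro r f ⟨F, hF, hfF, ha, hb⟩
    refine ⟨fun x => r * F x, continuousOn_const.mul hF, ?_, by simp [ha], by simp [hb]⟩
    filter_upwards [Lp.coeFn_smul r (f : L2 a b), hfF] with x h1 h2
    rw [Submodule.coe_smul, h1, Pi.smul_apply, h2, smul_eq_mul]

/-- The norm `‖φ‖_{W_0^{1,2}} = ‖φ'‖_{L²}`. -/
def W012norm {a b : ℝ} (φ : W012 a b) : ℝ := ‖weakDeriv (φ : W12 a b)‖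

/-! ### Poisson kernels and the operator `b₂` -/

/-- The Poisson kernel `P_y(x)` of the upper half-plane. -/
def poissonP (y x : ℝ) : ℝ := 1 / Real.pi * (y / (x ^ 2 + y ^ 2))

/-- The conjugate Poisson kernel `Q_y(x)`. -/
def poissonQ (y x : ℝ) : ℝ := 1 / Real.pi * (x / (x ^ 2 + y ^ 2))

/-- The convolution `k ⋆ u` on the real line. -/
def conv (k u : ℝ → ℝ) (x : ℝ) : ℝ := ∫ t, k (x - t) * u t

/-- The extension by zero to the real line of the `i`-th component of `m ∈ L²((a, b), ℝ²)`. -/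
def extComp {a b : ℝ} (m : L2vec a b) (i : Fin 2) : ℝ → ℝ :=
  (Ioo a b).indicator fun t => m t i

/-- The function `x ↦ -∂_y (Q_y ⋆ m̃₁ + P_y ⋆ m̃₂)(x)` at height `y = h`. -/
def fieldFun {a b : ℝ} (h : ℝ) (m : L2vec a b) (x : ℝ) : ℝ :=
  - deriv (fun y => conv (poissonQ y) (extComp m 0) x + conv (poissonP y) (extComp m 1) x) h

/-- The partial derivative in `y` of `P_y(x)`. -/
def dyP (y x : ℝ) : ℝ := 1 / Real.pi * ((x ^ 2 - y ^ 2) / (x ^ 2 + y ^ 2) ^ 2)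

/-- The partial derivative in `y` of `Q_y(x)`. -/
def dyQ (y x : ℝ) : ℝ := 1 / Real.pi * (-(2 * x * y) / (x ^ 2 + y ^ 2) ^ 2)

theorem hasDerivAt_poissonP {y : ℝ} (hy : 0 < y) (x : ℝ) :
    HasDerivAt (fun y => poissonP y x) (dyP y x) y := by
  have hne : x ^ 2 + y ^ 2 ≠ 0 := by positivity
  have h1 : HasDerivAt (fun y : ℝ => x ^ 2 + y ^ 2) (2 * y) y := by
    simpa using (hasDerivAt_pow 2 y).const_add (x ^ 2)
  have h2 := ((hasDerivAt_id y).div h1 hne).const_mul (1 / Real.pi)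
  refine h2.congr_deriv ?_
  simp only [dyP, id]
  congr 2
  ring

theorem hasDerivAt_poissonQ {y : ℝ} (hy : 0 < y) (x : ℝ) :
    HasDerivAt (fun y => poissonQ y x) (dyQ y x) y := by
  have hne : x ^ 2 + y ^ 2 ≠ 0 := by positivity
  have h1 : HasDerivAt (fun y : ℝ => x ^ 2 + y ^ 2) (2 * y) y := by
    simpa using (hasDerivAt_pow 2 y).const_add (x ^ 2)
  have h2 := ((hasDerivAt_const y x).div h1 hne).const_mul (1 / Real.pi)
  refine h2.congr_deriv ?_
  simp only [dyQ]
  congr 2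
  ring

theorem abs_aux {s n r : ℝ} (hr : 0 < r) (hn : r ≤ n) (hs : |s| ≤ n) :
    |1 / Real.pi * (s / n ^ 2)| ≤ 1 / Real.pi * (1 / r) := by
  have hpi : 0 < 1 / Real.pi := by positivity
  have hn0 : 0 < n := lt_of_lt_of_le hr hn
  rw [abs_mul, abs_of_pos hpi]
  refine mul_le_mul_of_nonneg_left ?_ hpi.le
  rw [abs_div, abs_of_pos (by positivity : (0 : ℝ) < n ^ 2), div_le_div_iff₀ (by positivity) hr]
  nlinarith [abs_nonneg s]

theorem abs_dyP_le {r y : ℝ} (hr : 0 < r) (hy : r ≤ y) (x : ℝ) :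
    |dyP y x| ≤ 1 / Real.pi * (1 / r ^ 2) := by
  refine abs_aux (by positivity) (by nlinarith [sq_nonneg x]) ?_
  rw [abs_le]
  constructor <;> nlinarith [sq_nonneg x, sq_nonneg y]

theorem abs_dyQ_le {r y : ℝ} (hr : 0 < r) (hy : r ≤ y) (x : ℝ) :
    |dyQ y x| ≤ 1 / Real.pi * (1 / r ^ 2) := by
  refine abs_aux (by positivity) (by nlinarith [sq_nonneg x]) ?_
  rw [abs_le]
  constructor <;> nlinarith [sq_nonneg (x - y), sq_nonneg (x + y)]

theorem continuous_dyP {y : ℝ} (hy : 0 < y) : Continuous (dyP y) := by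
  unfold dyP
  refine continuous_const.mul (Continuous.div (by fun_prop) (by fun_prop) fun x => ?_)
  positivity

theorem continuous_dyQ {y : ℝ} (hy : 0 < y) : Continuous (dyQ y) := by
  unfold dyQ
  refine continuous_const.mul (Continuous.div (by fun_prop) (by fun_prop) fun x => ?_)
  positivity

/-- Differentiation of a convolution with respect to the parameter of the kernel. -/
theorem hasDerivAt_conv {k k' : ℝ → ℝ → ℝ} {h : ℝ} (hh : 0 < h) {u : ℝ → ℝ} (hu : Integrable u)
    (hk : ∀ y, 0 < y → ∀ x, HasDerivAt (fun y => k y x) (k' y x) y)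
    (hkc : ∀ y, 0 < y → Continuous (k y)) (hk'c : Continuous (k' h))
    (hkb : ∃ C, ∀ x, |k h x| ≤ C)
    (hb : ∀ r, 0 < r → ∀ y, r ≤ y → ∀ x, |k' y x| ≤ 1 / Real.pi * (1 / r ^ 2)) (x : ℝ) :
    HasDerivAt (fun y => conv (k y) u x) (conv (k' h) u x) h := by
  obtain ⟨C, hC⟩ := hkb
  have hsub : Continuous fun t : ℝ => x - t := by fun_prop
  refine (hasDerivAt_integral_of_dominated_loc_of_deriv_le (μ := volume)
    (F := fun y t => k y (x - t) * u t) (F' := fun y t => k' y (x - t) * u t)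
    (bound := fun t => 1 / Real.pi * (1 / (h / 2) ^ 2) * |u t|) (Ioi_mem_nhds (half_lt_self hh))
    ?_ ?_ ?_ ?_ ?_ ?_).2
  · filter_upwards [Ioi_mem_nhds hh] with y hy
    exact ((hkc y hy).comp hsub).aestronglyMeasurable.mul hu.aestronglyMeasurable
  · exact hu.bdd_mul (c := C) ((hkc h hh).comp hsub).aestronglyMeasurable
      (Eventually.of_forall fun t => hC (x - t))
  · exact (hk'c.comp hsub).aestronglyMeasurable.mul hu.aestronglyMeasurable
  · refine Eventually.of_forall fun t y hy => ?_
    rw [Real.norm_eq_abs, abs_mul]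
    exact mul_le_mul_of_nonneg_right (hb (h / 2) (by positivity) y (le_of_lt hy) (x - t))
      (abs_nonneg _)
  · exact hu.abs.const_mul _
  · refine Eventually.of_forall fun t y hy => ?_
    have hy0 : 0 < y := lt_trans (by positivity) (mem_Ioi.mp hy)
    exact (hk y hy0 (x - t)).mul_const (u t)

theorem continuous_poissonP {y : ℝ} (hy : 0 < y) : Continuous (poissonP y) := by
  unfold poissonP
  refine continuous_const.mul (Continuous.div (by fun_prop) (by fun_prop) fun x => ?_)
  positivity

theorem continuous_poissonQ {y : ℝ} (hy : 0 < y) : Continuous (poissonQ y) := by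
  unfold poissonQ
  refine continuous_const.mul (Continuous.div (by fun_prop) (by fun_prop) fun x => ?_)
  positivity

theorem abs_poissonP_le {y : ℝ} (hy : 0 < y) (x : ℝ) :
    |poissonP y x| ≤ 1 / Real.pi * (1 / y) := by
  have hpi : 0 < 1 / Real.pi := by positivity
  rw [poissonP, abs_mul, abs_of_pos hpi]
  refine mul_le_mul_of_nonneg_left ?_ hpi.le
  rw [abs_div, abs_of_pos hy, abs_of_pos (by positivity : (0 : ℝ) < x ^ 2 + y ^ 2),
    div_le_div_iff₀ (by positivity) hy]
  nlinarith [sq_nonneg x]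

theorem abs_poissonQ_le {y : ℝ} (hy : 0 < y) (x : ℝ) :
    |poissonQ y x| ≤ 1 / Real.pi * (1 / y) := by
  have hpi : 0 < 1 / Real.pi := by positivity
  rw [poissonQ, abs_mul, abs_of_pos hpi]
  refine mul_le_mul_of_nonneg_left ?_ hpi.le
  rw [abs_div, abs_of_pos (by positivity : (0 : ℝ) < x ^ 2 + y ^ 2),
    div_le_div_iff₀ (by positivity) hy]
  nlinarith [sq_nonneg (|x| - y), sq_abs x, abs_nonneg x]

theorem integrable_comp {a b : ℝ} (m : L2vec a b) (i : Fin 2) :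
    Integrable (fun t => m t i) (volume.restrict (Ioo a b)) := by
  have h1 : Integrable (fun t => m t) (volume.restrict (Ioo a b)) :=
    (Lp.memLp m).integrable (by norm_num)
  exact (EuclideanSpace.proj i : EuclideanSpace ℝ (Fin 2) →L[ℝ] ℝ).integrable_comp h1

theorem integrable_extComp {a b : ℝ} (m : L2vec a b) (i : Fin 2) : Integrable (extComp m i) :=
  (integrable_indicator_iff measurableSet_Ioo).mpr (integrable_comp m i)

theorem conv_extComp {a b : ℝ} (k : ℝ → ℝ) (m : L2vec a b) (i : Fin 2) (x : ℝ) :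
    conv k (extComp m i) x = ∫ t in Ioo a b, k (x - t) * m t i := by
  rw [conv, ← integral_indicator measurableSet_Ioo]
  congr 1
  ext t
  by_cases ht : t ∈ Ioo a b <;> simp [extComp, ht]

/-- The derivative in the definition of `fieldFun` exists. -/
theorem hasDerivAt_field {a b h : ℝ} (hh : 0 < h) (m : L2vec a b) (x : ℝ) :
    HasDerivAt
      (fun y => conv (poissonQ y) (extComp m 0) x + conv (poissonP y) (extComp m 1) x)
      (conv (dyQ h) (extComp m 0) x + conv (dyP h) (extComp m 1) x) h :=
  (hasDerivAt_conv hh (integrable_extComp m 0) (fun _ hy => hasDerivAt_poissonQ hy)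
    (fun _ hy => continuous_poissonQ hy) (continuous_dyQ hh) ⟨_, abs_poissonQ_le hh⟩
    (fun _ hr _ hy => abs_dyQ_le hr hy) x).add
  (hasDerivAt_conv hh (integrable_extComp m 1) (fun _ hy => hasDerivAt_poissonP hy)
    (fun _ hy => continuous_poissonP hy) (continuous_dyP hh) ⟨_, abs_poissonP_le hh⟩
    (fun _ hr _ hy => abs_dyP_le hr hy) x)

theorem fieldFun_eq {a b h : ℝ} (hh : 0 < h) (m : L2vec a b) (x : ℝ) :
    fieldFun h m x = - ((∫ t in Ioo a b, dyQ h (x - t) * m t 0)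
      + ∫ t in Ioo a b, dyP h (x - t) * m t 1) := by
  rw [fieldFun, (hasDerivAt_field hh m x).deriv, conv_extComp, conv_extComp]

theorem integrable_kernel_mul {a b : ℝ} {k : ℝ → ℝ} (hk : Continuous k) {C : ℝ}
    (hC : ∀ x, |k x| ≤ C) (m : L2vec a b) (i : Fin 2) (x : ℝ) :
    Integrable (fun t => k (x - t) * m t i) (volume.restrict (Ioo a b)) :=
  (integrable_comp m i).bdd_mul (c := C) (hk.comp (by fun_prop)).aestronglyMeasurable
    (Eventually.of_forall fun t => hC (x - t))

theorem integrable_dyQ_mul {a b h : ℝ} (hh : 0 < h) (m : L2vec a b) (i : Fin 2) (x : ℝ) :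
    Integrable (fun t => dyQ h (x - t) * m t i) (volume.restrict (Ioo a b)) :=
  integrable_kernel_mul (continuous_dyQ hh) (abs_dyQ_le hh le_rfl) m i x

theorem integrable_dyP_mul {a b h : ℝ} (hh : 0 < h) (m : L2vec a b) (i : Fin 2) (x : ℝ) :
    Integrable (fun t => dyP h (x - t) * m t i) (volume.restrict (Ioo a b)) :=
  integrable_kernel_mul (continuous_dyP hh) (abs_dyP_le hh le_rfl) m i x

theorem continuous_integral_kernel {a b : ℝ} {k : ℝ → ℝ} (hk : Continuous k) {C : ℝ}
    (hC : ∀ x, |k x| ≤ C) (m : L2vec a b) (i : Fin 2) :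
    Continuous fun x => ∫ t in Ioo a b, k (x - t) * m t i := by
  refine continuous_of_dominated (bound := fun t => C * |m t i|)
    (fun x => (integrable_kernel_mul hk hC m i x).aestronglyMeasurable) ?_
    ((integrable_comp m i).abs.const_mul C) ?_
  · intro x
    refine Eventually.of_forall fun t => ?_
    rw [Real.norm_eq_abs, abs_mul]
    exact mul_le_mul_of_nonneg_right (hC _) (abs_nonneg _)
  · exact Eventually.of_forall fun t => by fun_prop

theorem continuous_fieldFun {a b h : ℝ} (hh : 0 < h) (m : L2vec a b) :
    Continuous (fieldFun h m) := by
  have e : fieldFun h m = fun x => - ((∫ t in Ioo a b, dyQ h (x - t) * m t 0)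
      + ∫ t in Ioo a b, dyP h (x - t) * m t 1) := funext (fieldFun_eq hh m)
  rw [e]
  exact ((continuous_integral_kernel (continuous_dyQ hh) (abs_dyQ_le hh le_rfl) m 0).add
    (continuous_integral_kernel (continuous_dyP hh) (abs_dyP_le hh le_rfl) m 1)).neg

theorem integral_norm_le {a b : ℝ} (m : L2vec a b) :
    ∫ t in Ioo a b, ‖m t‖ ≤ (volume.restrict (Ioo a b)).real univ ^ (1 / 2 : ℝ) * ‖m‖ := by
  have hm := Lp.memLp m
  have h1 : eLpNorm m 1 (volume.restrict (Ioo a b)) ≤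
      eLpNorm m 2 (volume.restrict (Ioo a b)) *
        (volume.restrict (Ioo a b)) univ ^ (1 / (1 : ENNReal).toReal - 1 / (2 : ENNReal).toReal) :=
    eLpNorm_le_eLpNorm_mul_rpow_measure_univ (by norm_num) hm.1
  have hfin : eLpNorm m 2 (volume.restrict (Ioo a b)) *
      (volume.restrict (Ioo a b)) univ ^
        (1 / (1 : ENNReal).toReal - 1 / (2 : ENNReal).toReal) ≠ ⊤ :=
    ENNReal.mul_ne_top hm.2.ne
      (ENNReal.rpow_ne_top_of_nonneg (by norm_num) (measure_ne_top _ _))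
  have h2 := ENNReal.toReal_mono hfin h1
  rw [integral_norm_eq_lintegral_enorm hm.1, ← eLpNorm_one_eq_lintegral_enorm]
  refine h2.trans (le_of_eq ?_)
  rw [ENNReal.toReal_mul, ← ENNReal.toReal_rpow, Lp.norm_def, mul_comm, Measure.real]
  norm_num

theorem abs_integral_kernel_le {a b : ℝ} {k : ℝ → ℝ} {C : ℝ}
    (hC : ∀ x, |k x| ≤ C) (m : L2vec a b) (i : Fin 2) (x : ℝ) :
    |∫ t in Ioo a b, k (x - t) * m t i| ≤ C * ∫ t in Ioo a b, ‖m t‖ := by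
  have hi : Integrable (fun t => m t) (volume.restrict (Ioo a b)) :=
    (Lp.memLp m).integrable (by norm_num)
  rw [← integral_const_mul, ← Real.norm_eq_abs]
  refine norm_integral_le_of_norm_le (hi.norm.const_mul C) (Eventually.of_forall fun t => ?_)
  rw [Real.norm_eq_abs, abs_mul, ← Real.norm_eq_abs (m t i)]
  exact mul_le_mul (hC _) (PiLp.norm_apply_le (m t) i) (norm_nonneg _)
    ((abs_nonneg _).trans (hC 0))

theorem abs_fieldFun_le {a b h : ℝ} (hh : 0 < h) (m : L2vec a b) (x : ℝ) :
    |fieldFun h m x| ≤ 2 * (1 / Real.pi * (1 / h ^ 2)) *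
      ((volume.restrict (Ioo a b)).real univ ^ (1 / 2 : ℝ)) * ‖m‖ := by
  have hC : 0 ≤ 1 / Real.pi * (1 / h ^ 2) := by positivity
  have h1 := abs_integral_kernel_le (abs_dyQ_le hh le_rfl) m 0 x
  have h2 := abs_integral_kernel_le (abs_dyP_le hh le_rfl) m 1 x
  have h3 := mul_le_mul_of_nonneg_left (integral_norm_le m) hC
  rw [fieldFun_eq hh, abs_neg]
  refine (abs_add_le _ _).trans ?_
  linarith

theorem memLp_fieldFun {a b h : ℝ} (c d : ℝ) (hh : 0 < h) (m : L2vec a b) :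
    MemLp (fieldFun h m) 2 (volume.restrict (Ioo c d)) :=
  MemLp.of_bound (continuous_fieldFun hh m).aestronglyMeasurable _
    (Eventually.of_forall fun x => abs_fieldFun_le hh m x)

theorem fieldFun_add {a b h : ℝ} (hh : 0 < h) (m n : L2vec a b) (x : ℝ) :
    fieldFun h (m + n) x = fieldFun h m x + fieldFun h n x := by
  have e : ∀ (k : ℝ → ℝ) (i : Fin 2), ∫ t in Ioo a b, k (x - t) * (m + n : L2vec a b) t i
      = ∫ t in Ioo a b, (k (x - t) * m t i + k (x - t) * n t i) := by
    intro k i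
    refine integral_congr_ae ?_
    filter_upwards [Lp.coeFn_add m n] with t ht
    rw [ht, Pi.add_apply, PiLp.add_apply, mul_add]
  rw [fieldFun_eq hh, fieldFun_eq hh, fieldFun_eq hh, e, e,
    integral_add (integrable_dyQ_mul hh m 0 x) (integrable_dyQ_mul hh n 0 x),
    integral_add (integrable_dyP_mul hh m 1 x) (integrable_dyP_mul hh n 1 x)]
  ring

theorem fieldFun_smul {a b h : ℝ} (hh : 0 < h) (r : ℝ) (m : L2vec a b) (x : ℝ) :
    fieldFun h (r • m) x = r * fieldFun h m x := by
  have e : ∀ (k : ℝ → ℝ) (i : Fin 2), ∫ t in Ioo a b, k (x - t) * (r • m : L2vec a b) t i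
      = ∫ t in Ioo a b, r * (k (x - t) * m t i) := by
    intro k i
    refine integral_congr_ae ?_
    filter_upwards [Lp.coeFn_smul r m] with t ht
    rw [ht, Pi.smul_apply, PiLp.smul_apply, smul_eq_mul]
    ring
  rw [fieldFun_eq hh, fieldFun_eq hh, e, e, integral_const_mul, integral_const_mul]
  ring

/-- The bounded operator `b₂ : L²(S, ℝ²) → L²(K)` with `S = (a, b)` and `K = (c, d)`, given by
`b₂[m] = -∂_y (Q_y ⋆ m̃₁ + P_y ⋆ m̃₂)` restricted to `K × {h}`. -/
def b2 (a b c d : ℝ) {h : ℝ} (hh : 0 < h) : L2vec a b →L[ℝ] L2 c d :=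
  LinearMap.mkContinuous
    { toFun := fun m => (memLp_fieldFun c d hh m).toLp (fieldFun h m)
      map_add' := fun m n => by
        rw [← MemLp.toLp_add]
        exact MemLp.toLp_congr _ _ (Eventually.of_forall fun x => fieldFun_add hh m n x)
      map_smul' := fun r m => by
        rw [RingHom.id_apply, ← MemLp.toLp_const_smul]
        exact MemLp.toLp_congr _ _ (Eventually.of_forall fun x => fieldFun_smul hh r m x) }
    ((measureUnivNNReal (volume.restrict (Ioo c d)) : ℝ) ^ (2 : ENNReal).toReal⁻¹ * (2 * (1 / Real.pi * (1 / h ^ 2)) *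
      ((volume.restrict (Ioo a b)).real univ ^ (1 / 2 : ℝ))))
    (fun m => by
      have hb := Lp.norm_le_of_ae_bound (p := 2) (f := (memLp_fieldFun c d hh m).toLp (fieldFun h m))
        (C := 2 * (1 / Real.pi * (1 / h ^ 2)) *
          ((volume.restrict (Ioo a b)).real univ ^ (1 / 2 : ℝ)) * ‖m‖) (by positivity) (by
          filter_upwards [(memLp_fieldFun c d hh m).coeFn_toLp] with x hx
          rw [hx]
          exact abs_fieldFun_le hh m x)
      exact hb.trans (le_of_eq (mul_assoc _ _ _).symm))

theorem b2_coeFn (a b c d : ℝ) {h : ℝ} (hh : 0 < h) (m : L2vec a b) :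
    b2 a b c d hh m =ᵐ[volume.restrict (Ioo c d)] fieldFun h m :=
  (memLp_fieldFun c d hh m).coeFn_toLp

/-- The Hilbert space adjoint `b₂* : L²(K) → L²(S, ℝ²)` of `b₂`. -/
def b2star (a b c d : ℝ) {h : ℝ} (hh : 0 < h) : L2 c d →L[ℝ] L2vec a b :=
  ContinuousLinearMap.adjoint (b2 a b c d hh)

/-- The restriction of `b₂*` to `W_0^{1,2}(K)`. -/
def b2starW (a b c d : ℝ) {h : ℝ} (hh : 0 < h) (φ : W012 c d) : L2vec a b :=
  b2star a b c d hh ((φ : W12 c d) : L2 c d)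

/-- `φo` solves the bounded extremal problem with data `e` and bound `M`: it belongs to the set of
`φ ∈ W_0^{1,2}(K)` with `‖φ‖_{W_0^{1,2}(K)} ≤ M`, and it minimizes `‖b₂*[φ] - e‖` over this set. -/
def IsBEPSolution {a b c d h : ℝ} (hh : 0 < h) (e : L2vec a b) (M : ℝ) (φo : W012 c d) : Prop :=
  W012norm φo ≤ M ∧
    IsMinOn (fun φ : W012 c d => ‖b2starW a b c d hh φ - e‖) {φ | W012norm φ ≤ M} φo

end NetMoment

end

namespace NetMoment

/-! ### Integrals of Cauchy type with squared kernel -/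

/-! Write `S = (a, b)` and `K = (c, d)`. Differentiation identifies `W_0^{1,2}(K)` isometrically
with the mean-zero functions in `L²(K)`, the inverse being the primitive vanishing at `c`
(`coe_eq_primitive_weakDeriv`, `primitiveW`). The problem thus asks for the distance from `e` to the
image of a closed ball of a Hilbert space under a bounded operator, and this is attained by weak
compactness (`exists_isMinOn_norm_sub_closedBall`).

Uniqueness follows from strict convexity of the `L²` norm and injectivity of `b₂*`. If the
constraint is slack at a solution `φ`, every direction is admissible, so `b₂*φ - e` is orthogonal to
`b₂*[W_0^{1,2}]`. Hence `b₂(b₂*φ - e)` is orthogonal to a dense subspace and vanishes, and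
injectivity of `b₂` gives `b₂*φ = e`.

Both injectivity statements rest on `∂_y P_y(x) + i ∂_y Q_y(x) = 1 / (π (x + iy)²)`. If `b₂*φ = 0`,
the integral `∫ φ(x) / (z - x)² dx` vanishes on a segment off the real axis. It is analytic outside
the closure of `K`, including at infinity, where its expansion has the moments of `φ` as
coefficients up to nonzero factors; all moments vanish, so `φ = 0`. If `b₂ m = 0`, a sum of two such
integrals with conjugate densities and different singular lines vanishes on a segment, and
Liouville's theorem separates them (`ae_eq_zero_of_cauchySq_add_eq_zero`). -/

theorem ae_eq_zero_of_forall_integral_pow_eq_zero {a b : ℝ} {μ : ℝ → ℂ}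
    (hμ : IntegrableOn μ (Ioo a b)) (h : ∀ n : ℕ, ∫ t in Ioo a b, μ t * (t : ℂ) ^ n = 0) :
    μ =ᵐ[volume.restrict (Ioo a b)] 0 := by
  have hpow : ∀ p : Polynomial ℝ, Integrable (fun t : ℝ => μ t * ((p.eval t : ℝ) : ℂ))
      (volume.restrict (Ioo a b)) := fun p => by
    obtain ⟨C, hC⟩ := (isCompact_Icc (a := a) (b := b)).exists_bound_of_continuousOn
      (f := fun t : ℝ => ((p.eval t : ℝ) : ℂ)) (by fun_prop)
    refine hμ.mul_bdd (c := C) (by fun_prop) ?_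
    exact (ae_restrict_iff' measurableSet_Ioo).2
      (Eventually.of_forall fun t ht => hC t (Ioo_subset_Icc_self ht))
  have hpoly : ∀ p : Polynomial ℝ, ∫ t in Ioo a b, μ t * ((p.eval t : ℝ) : ℂ) = 0 := by
    intro p
    induction p using Polynomial.induction_on' with
    | add p q hp hq =>
      have e : (fun t : ℝ => μ t * (((p + q).eval t : ℝ) : ℂ))
          = fun t => μ t * ((p.eval t : ℝ) : ℂ) + μ t * ((q.eval t : ℝ) : ℂ) := by
        ext t
        simp [mul_add]
      rw [e, integral_add (hpow p) (hpow q), hp, hq, add_zero]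
    | monomial n r =>
      have e : (fun t : ℝ => μ t * (((Polynomial.monomial n r).eval t : ℝ) : ℂ))
          = fun t => (r : ℂ) * (μ t * (t : ℂ) ^ n) := by
        ext t
        simp
        ring
      rw [e, integral_const_mul, h, mul_zero]
  -- Weierstrass approximation: uniform convergence on `[a, b]` against an integrable density passes
  -- from polynomials to continuous functions.
  have key : ∀ η : ℝ → ℝ, Continuous η → ∫ t in Ioo a b, μ t * (η t : ℂ) = 0 := by
    intro η hη
    obtain ⟨D, hD⟩ := (isCompact_Icc (a := a) (b := b)).exists_bound_of_continuousOn
      (f := fun t : ℝ => (η t : ℂ)) (by fun_prop)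
    have hint : Integrable (fun t : ℝ => μ t * (η t : ℂ)) (volume.restrict (Ioo a b)) := by
      refine hμ.mul_bdd (c := D) (by fun_prop) ?_
      exact (ae_restrict_iff' measurableSet_Ioo).2
        (Eventually.of_forall fun t ht => hD t (Ioo_subset_Icc_self ht))
    set I := ∫ t in Ioo a b, ‖μ t‖ with hI
    have hI0 : 0 ≤ I := integral_nonneg fun t => norm_nonneg _
    rw [← norm_le_zero_iff]
    refine le_of_forall_pos_le_add fun ε hε => ?_
    -- The final error is `I * ε / (I + 1) ≤ ε`; the `+ 1` covers the case `I = 0`.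
    obtain ⟨p, hp⟩ := exists_polynomial_near_of_continuousOn a b η hη.continuousOn
      (ε / (I + 1)) (by positivity)
    have e : ∫ t in Ioo a b, μ t * (η t : ℂ)
        = ∫ t in Ioo a b, (μ t * (η t : ℂ) - μ t * ((p.eval t : ℝ) : ℂ)) := by
      rw [integral_sub hint (hpow p), hpoly p, sub_zero]
    rw [e, zero_add]
    have hle : ‖∫ t in Ioo a b, (μ t * (η t : ℂ) - μ t * ((p.eval t : ℝ) : ℂ))‖
        ≤ ∫ t in Ioo a b, ‖μ t‖ * (ε / (I + 1)) := by
      refine norm_integral_le_of_norm_le (hμ.norm.mul_const _) ?_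
      refine (ae_restrict_iff' measurableSet_Ioo).2 (Eventually.of_forall fun t ht => ?_)
      rw [← mul_sub, norm_mul, ← Complex.ofReal_sub, Complex.norm_real, Real.norm_eq_abs,
        abs_sub_comm]
      exact mul_le_mul_of_nonneg_left (hp t (Ioo_subset_Icc_self ht)).le (norm_nonneg _)
    refine hle.trans ?_
    rw [integral_mul_const, ← hI, mul_div_assoc', div_le_iff₀ (by positivity)]
    nlinarith
  have := isOpen_Ioo.ae_eq_zero_of_integral_contDiff_smul_eq_zero (μ := volume)
    (U := Ioo a b) (f := μ) hμ.locallyIntegrableOn (by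
      intro η hη hc hs
      have hz : ∀ x, x ∉ Ioo a b → η x • μ x = 0 := by
        intro x hx
        have : η x = 0 := image_eq_zero_of_notMem_tsupport (fun hx' => hx (hs hx'))
        simp [this]
      rw [← setIntegral_eq_integral_of_forall_compl_eq_zero hz, ← key η hη.continuous]
      congr 1
      ext t
      simp [mul_comm])
  exact (ae_restrict_iff' measurableSet_Ioo).2 this

/-- The integral of `μ(t) tⁿ / (1 - t w)ⁿ⁺²` over `(a, b)`. -/
noncomputable def momentFun (a b : ℝ) (μ : ℝ → ℂ) (n : ℕ) (w : ℂ) : ℂ :=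
  ∫ t in Ioo a b, μ t * ((t : ℂ) ^ n / (1 - t * w) ^ (n + 2))

/-- A domain, starlike about `0`, on which `1 - t w ≠ 0` for all real `t` with `|t| ≤ R`. -/
def slitDomain (R : ℝ) : Set ℂ := {w | w.im ≠ 0 ∨ R * |w.re| < 1}

theorem isOpen_slitDomain (R : ℝ) : IsOpen (slitDomain R) :=
  (isOpen_ne_fun Complex.continuous_im continuous_const).union
    (isOpen_lt (continuous_const.mul Complex.continuous_re.abs) continuous_const)

theorem zero_mem_slitDomain (R : ℝ) : (0 : ℂ) ∈ slitDomain R := Or.inr (by simp)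

theorem isPreconnected_slitDomain {R : ℝ} (hR : 0 ≤ R) : IsPreconnected (slitDomain R) := by
  have h : StarConvex ℝ (0 : ℂ) (slitDomain R) := by
    refine starConvex_zero_iff.2 fun w hw s hs0 hs1 => ?_
    rcases hs0.eq_or_lt with rfl | hs
    · simpa using zero_mem_slitDomain R
    · rcases hw with hw | hw
      · exact Or.inl (by simpa using ⟨hs.ne', hw⟩)
      · refine Or.inr (lt_of_le_of_lt ?_ hw)
        simp only [Complex.real_smul, Complex.mul_re, Complex.ofReal_re, Complex.ofReal_im,
          zero_mul, sub_zero, abs_mul, abs_of_pos hs]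
        exact mul_le_mul_of_nonneg_left (mul_le_of_le_one_left (abs_nonneg _) hs1) hR
  exact (h.isPathConnected (zero_mem_slitDomain R)).isConnected.isPreconnected

theorem one_sub_mul_ne_zero {R t : ℝ} (ht : |t| ≤ R) {w : ℂ} (hw : w ∈ slitDomain R) :
    (1 : ℂ) - t * w ≠ 0 := by
  intro h0
  have hre : 1 - t * w.re = 0 := by simpa using congrArg Complex.re h0
  have him : t * w.im = 0 := by simpa using congrArg Complex.im h0
  rcases hw with hw | hw
  · have : t = 0 := by simpa [hw] using him
    simp [this] at hre
  · have h1 : t * w.re ≤ R * |w.re| := by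
      refine (le_abs_self _).trans ?_
      rw [abs_mul]
      exact mul_le_mul_of_nonneg_right ht (abs_nonneg _)
    linarith

/-- The exponent `n + 2` makes the family closed under differentiation: each derivative raises both
`n` and the order of the pole by one. Domination comes from continuity of the kernels on the compact
product of `[-R, R]` with a small closed ball. -/
theorem hasDerivAt_momentFun {a b R : ℝ} (hR : ∀ t ∈ Ioo a b, |t| ≤ R) {μ : ℝ → ℂ}
    (hμ : IntegrableOn μ (Ioo a b)) (n : ℕ) {w : ℂ} (hw : w ∈ slitDomain R) :
    HasDerivAt (momentFun a b μ n) ((n + 2) * momentFun a b μ (n + 1) w) w := by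
  obtain ⟨r, hr, hball⟩ := Metric.nhds_basis_closedBall.mem_iff.1 ((isOpen_slitDomain R).mem_nhds hw)
  have hcont : ∀ m : ℕ, ContinuousOn
      (fun p : ℝ × ℂ => (p.1 : ℂ) ^ m / (1 - p.1 * p.2) ^ (m + 2))
      (Icc (-R) R ×ˢ Metric.closedBall w r) := by
    intro m
    refine ContinuousOn.div (by fun_prop) (by fun_prop) ?_
    rintro ⟨t, v⟩ ⟨ht, hv⟩
    exact pow_ne_zero _ (one_sub_mul_ne_zero (abs_le.2 ht) (hball hv))
  have hbd : ∀ m : ℕ, ∃ C, ∀ t ∈ Ioo a b, ∀ v ∈ Metric.closedBall w r,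
      ‖(t : ℂ) ^ m / (1 - t * v) ^ (m + 2)‖ ≤ C := by
    intro m
    obtain ⟨C, hC⟩ := (isCompact_Icc.prod (isCompact_closedBall w r)).exists_bound_of_continuousOn
      (hcont m)
    exact ⟨C, fun t ht v hv => hC (t, v) ⟨abs_le.1 (hR t ht), hv⟩⟩
  have hmeas : ∀ (m : ℕ) (v : ℂ), AEStronglyMeasurable
      (fun t : ℝ => (t : ℂ) ^ m / (1 - t * v) ^ (m + 2)) (volume.restrict (Ioo a b)) :=
    fun m v => Measurable.aestronglyMeasurable (by fun_prop)
  obtain ⟨C, hC⟩ := hbd n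
  obtain ⟨D, hD⟩ := hbd (n + 1)
  have key := (hasDerivAt_integral_of_dominated_loc_of_deriv_le
    (μ := volume.restrict (Ioo a b)) (x₀ := w)
    (F := fun v t => μ t * ((t : ℂ) ^ n / (1 - t * v) ^ (n + 2)))
    (F' := fun v t => (n + 2) * (μ t * ((t : ℂ) ^ (n + 1) / (1 - t * v) ^ (n + 1 + 2))))
    (bound := fun t => ‖((n : ℂ) + 2)‖ * (‖μ t‖ * D)) (Metric.closedBall_mem_nhds w hr)
    (Eventually.of_forall fun v => hμ.aestronglyMeasurable.mul (hmeas n v))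
    (hμ.mul_bdd (c := C) (hmeas n w) ?_)
    ((hμ.aestronglyMeasurable.mul (hmeas (n + 1) w)).const_mul _) ?_
    ((hμ.norm.mul_const D).const_mul _) ?_).2
  · rwa [integral_const_mul] at key
  · exact (ae_restrict_iff' measurableSet_Ioo).2 (Eventually.of_forall fun t ht =>
      hC t ht w (Metric.mem_closedBall_self hr.le))
  · refine (ae_restrict_iff' measurableSet_Ioo).2 (Eventually.of_forall fun t ht v hv => ?_)
    rw [norm_mul, norm_mul]
    gcongr
    exact hD t ht v hv
  · refine (ae_restrict_iff' measurableSet_Ioo).2 (Eventually.of_forall fun t ht v hv => ?_)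
    have hne := one_sub_mul_ne_zero (hR t ht) (hball hv)
    have h1 : HasDerivAt (fun v : ℂ => 1 - t * v) (-t) v := by
      simpa using ((hasDerivAt_id v).const_mul (t : ℂ)).const_sub 1
    refine (((hasDerivAt_const v ((t : ℂ) ^ n)).div (h1.pow (n + 2))
      (pow_ne_zero _ hne)).const_mul (μ t)).congr_deriv ?_
    push_cast
    field_simp
    simp
    ring

/-- The integral `∫ μ(t) / (z - t)² dt` over `(a, b)`: up to sign, the derivative of the Cauchy
transform of `μ`. -/
noncomputable def cauchySq (a b : ℝ) (μ : ℝ → ℂ) (z : ℂ) : ℂ :=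
  ∫ t in Ioo a b, μ t / (z - t) ^ 2

/-- The inversion `z = 1 / w` moves infinity to `0`, where Taylor coefficients are multiples of
moments. It also joins the two half-planes inside one connected domain. -/
theorem cauchySq_inv {a b : ℝ} (μ : ℝ → ℂ) {w : ℂ} (hw : w ≠ 0) :
    cauchySq a b μ w⁻¹ = w ^ 2 * momentFun a b μ 0 w := by
  rw [cauchySq, momentFun, ← integral_const_mul]
  congr 1
  ext t
  have e : w⁻¹ - t = w⁻¹ * (1 - t * w) := by field_simp
  rw [e, mul_pow, inv_pow]
  -- At a pole both integrands are `0` by the convention for division by zero, so `w` may be real.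
  by_cases h : (1 : ℂ) - t * w = 0
  · simp [h]
  · field_simp

theorem abs_le_max_abs_of_mem_Ioo {a b t : ℝ} (ht : t ∈ Ioo a b) : |t| ≤ max |a| |b| :=
  abs_le_max_abs_abs ht.1.le ht.2.le

theorem momentFun_eqOn_zero {a b : ℝ} {μ : ℝ → ℂ} (hμ : IntegrableOn μ (Ioo a b)) {w : ℂ}
    (hw : w ∈ slitDomain (max |a| |b|)) (h : ∃ᶠ v in 𝓝[≠] w, momentFun a b μ 0 v = 0) :
    EqOn (momentFun a b μ 0) 0 (slitDomain (max |a| |b|)) := by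
  refine AnalyticOnNhd.eqOn_zero_of_preconnected_of_frequently_eq_zero ?_
    (isPreconnected_slitDomain (le_max_of_le_left (abs_nonneg a))) hw h
  refine DifferentiableOn.analyticOnNhd (fun v hv => ?_) (isOpen_slitDomain _)
  exact (hasDerivAt_momentFun (fun t => abs_le_max_abs_of_mem_Ioo) hμ 0
    hv).differentiableAt.differentiableWithinAt

/-- Differentiating repeatedly kills every `momentFun a b μ n`; its value at `w = 0` is the `n`-th
moment of `μ`. -/
theorem ae_eq_zero_of_momentFun_eqOn_zero {a b : ℝ} {μ : ℝ → ℂ} (hμ : IntegrableOn μ (Ioo a b))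
    (h : EqOn (momentFun a b μ 0) 0 (slitDomain (max |a| |b|))) :
    μ =ᵐ[volume.restrict (Ioo a b)] 0 := by
  have hall : ∀ n : ℕ, EqOn (momentFun a b μ n) 0 (slitDomain (max |a| |b|)) := by
    intro n
    induction n with
    | zero => exact h
    | succ n ih =>
      intro w hw
      have h1 := hasDerivAt_momentFun (fun t => abs_le_max_abs_of_mem_Ioo) hμ n hw
      have h2 : HasDerivAt (momentFun a b μ n) 0 w :=
        (hasDerivAt_const w (0 : ℂ)).congr_of_eventuallyEq
          (ih.eventuallyEq_of_mem ((isOpen_slitDomain _).mem_nhds hw))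
      have h3 := h1.unique h2
      have h4 : ((n : ℂ) + 2) ≠ 0 := by exact_mod_cast (by omega : n + 2 ≠ 0)
      exact (mul_eq_zero.1 h3).resolve_left h4
  refine ae_eq_zero_of_forall_integral_pow_eq_zero hμ fun n => ?_
  simpa [momentFun] using hall n (zero_mem_slitDomain _)

/-- Uniqueness for `cauchySq`: if it vanishes at points accumulating at a nonreal point, then the
density vanishes. -/
theorem ae_eq_zero_of_frequently_cauchySq_eq_zero {a b : ℝ} {μ : ℝ → ℂ}
    (hμ : IntegrableOn μ (Ioo a b)) {z : ℂ} (hz : z.im ≠ 0)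
    (h : ∃ᶠ v in 𝓝[≠] z, cauchySq a b μ v = 0) : μ =ᵐ[volume.restrict (Ioo a b)] 0 := by
  have hz0 : z ≠ 0 := by
    rintro rfl
    simp at hz
  have him : z⁻¹ ∈ slitDomain (max |a| |b|) := by
    refine Or.inl ?_
    rw [Complex.inv_im]
    exact div_ne_zero (neg_ne_zero.2 hz) (by simpa using hz0)
  refine ae_eq_zero_of_momentFun_eqOn_zero hμ (momentFun_eqOn_zero hμ him ?_)
  have ht : Tendsto (fun v : ℂ => v⁻¹) (𝓝[≠] z) (𝓝[≠] z⁻¹) := by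
    refine tendsto_nhdsWithin_iff.2 ⟨(tendsto_inv₀ hz0).mono_left nhdsWithin_le_nhds, ?_⟩
    filter_upwards [self_mem_nhdsWithin] with v hv
    simpa using hv
  refine ht.frequently ?_
  have hne : ∀ᶠ v in 𝓝[≠] z, v ≠ 0 := nhdsWithin_le_nhds (isOpen_ne.mem_nhds hz0)
  refine (h.and_eventually hne).mono fun v hv => ?_
  have h1 := cauchySq_inv (a := a) (b := b) μ (inv_ne_zero hv.2)
  rw [inv_inv, hv.1] at h1
  exact (mul_eq_zero.1 h1.symm).resolve_left (pow_ne_zero _ (inv_ne_zero hv.2))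

theorem differentiableAt_cauchySq {a b : ℝ} {μ : ℝ → ℂ} (hμ : IntegrableOn μ (Ioo a b)) {z : ℂ}
    (hz : z.im ≠ 0) : DifferentiableAt ℂ (cauchySq a b μ) z := by
  have hz0 : z ≠ 0 := by
    rintro rfl
    simp at hz
  have him : z⁻¹ ∈ slitDomain (max |a| |b|) := by
    refine Or.inl ?_
    rw [Complex.inv_im]
    exact div_ne_zero (neg_ne_zero.2 hz) (by simpa using hz0)
  have h1 : DifferentiableAt ℂ (fun v : ℂ => v⁻¹ ^ 2 * momentFun a b μ 0 v⁻¹) z := by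
    have hi : DifferentiableAt ℂ (fun v : ℂ => v⁻¹) z := differentiableAt_inv hz0
    have hm : DifferentiableAt ℂ (momentFun a b μ 0) z⁻¹ :=
      (hasDerivAt_momentFun (fun t => abs_le_max_abs_of_mem_Ioo) hμ 0 him).differentiableAt
    exact (hi.pow 2).mul (hm.comp z hi)
  refine h1.congr_of_eventuallyEq ?_
  filter_upwards [isOpen_ne.mem_nhds hz0] with v hv
  rw [← cauchySq_inv μ (inv_ne_zero hv), inv_inv]

/-- For real `t`, `|z - t| ≥ |Im z|`. This gives both the boundedness and the decay used with
Liouville's theorem. -/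
theorem norm_cauchySq_le {a b : ℝ} {μ : ℝ → ℂ} (hμ : IntegrableOn μ (Ioo a b)) {r : ℝ}
    (hr : 0 < r) {z : ℂ} (hz : r ≤ |z.im|) :
    ‖cauchySq a b μ z‖ ≤ (∫ t in Ioo a b, ‖μ t‖) / r ^ 2 := by
  rw [← integral_div]
  refine norm_integral_le_of_norm_le (hμ.norm.div_const _) (Eventually.of_forall fun t => ?_)
  rw [norm_div, norm_pow]
  have : r ≤ ‖z - t‖ := by
    refine hz.trans ?_
    simpa using Complex.abs_im_le_norm (z - t)
  gcongr

theorem frequently_nhdsNE_add_mul_I {c d y : ℝ} {x : ℝ} (hx : x ∈ Ioo c d) {f : ℂ → ℂ}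
    (h : ∀ s ∈ Ioo c d, f (s + y * Complex.I) = 0) :
    ∃ᶠ v in 𝓝[≠] (x + y * Complex.I : ℂ), f v = 0 := by
  have ht : Tendsto (fun s : ℝ => (s + y * Complex.I : ℂ)) (𝓝[≠] x)
      (𝓝[≠] (x + y * Complex.I : ℂ)) := by
    refine tendsto_nhdsWithin_iff.2 ⟨?_, ?_⟩
    · exact (Continuous.tendsto (by fun_prop) x).mono_left nhdsWithin_le_nhds
    · filter_upwards [self_mem_nhdsWithin] with s hs
      simpa using hs
  refine ht.frequently (Eventually.frequently ?_)
  filter_upwards [nhdsWithin_le_nhds (Ioo_mem_nhds hx.1 hx.2)] with s hs using h s hs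

/-- If `cauchySq μ z + cauchySq ν (z - 2ih)` vanishes on a segment of the line `Im z = h`, then the
two summands are pieces of a bounded entire function vanishing at infinity, and `μ` vanishes. -/
theorem ae_eq_zero_of_cauchySq_add_eq_zero {a b c d h : ℝ} (hcd : c < d) (hh : 0 < h)
    {μ ν : ℝ → ℂ} (hμ : IntegrableOn μ (Ioo a b)) (hν : IntegrableOn ν (Ioo a b))
    (hz : ∀ x ∈ Ioo c d, cauchySq a b μ (x + h * Complex.I)
      + cauchySq a b ν (x + h * Complex.I - 2 * h * Complex.I) = 0) :
    μ =ᵐ[volume.restrict (Ioo a b)] 0 := by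
  -- The shift moves the singularities of the second integral to the line `Im z = 2h`, so `g` is
  -- holomorphic below it, while the first integral is holomorphic above the real axis. The overlap
  -- is the strip `U`, which contains the given segment.
  set g : ℂ → ℂ := fun z => cauchySq a b ν (z - 2 * h * Complex.I) with hg
  have imsub : ∀ z : ℂ, (z - 2 * h * Complex.I).im = z.im - 2 * h := fun z => by simp
  have hgd : ∀ z : ℂ, z.im < 2 * h → DifferentiableAt ℂ g z := by
    intro z hz
    have h1 : DifferentiableAt ℂ (cauchySq a b ν) (z - 2 * h * Complex.I) :=
      differentiableAt_cauchySq hν (by rw [imsub]; linarith)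
    exact DifferentiableAt.comp (g := cauchySq a b ν) (f := fun z => z - 2 * h * Complex.I) z h1
      (differentiableAt_id.sub_const _)
  have hfd : ∀ z : ℂ, 0 < z.im → DifferentiableAt ℂ (cauchySq a b μ) z :=
    fun z hz => differentiableAt_cauchySq hμ hz.ne'
  set U : Set ℂ := {z | 0 < z.im} ∩ {z | z.im < 2 * h} with hU
  have hUo : IsOpen U := (isOpen_lt continuous_const Complex.continuous_im).inter
    (isOpen_lt Complex.continuous_im continuous_const)
  have hUc : IsPreconnected U :=
    ((convex_halfSpace_im_gt 0).inter (convex_halfSpace_im_lt (2 * h))).isPreconnected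
  obtain ⟨x, hx⟩ := exists_between hcd
  have hsum : EqOn (fun z => cauchySq a b μ z + g z) 0 U := by
    refine AnalyticOnNhd.eqOn_zero_of_preconnected_of_frequently_eq_zero
      (DifferentiableOn.analyticOnNhd (fun v hv => ((hfd v hv.1).add
        (hgd v hv.2)).differentiableWithinAt) hUo) hUc (z₀ := x + h * Complex.I) ?_
      (frequently_nhdsNE_add_mul_I hx hz)
    constructor <;> simp <;> linarith
  classical
  -- On `U` the two formulas agree, so `F` is entire. Switching at height `h` keeps each formula at
  -- distance at least `h` from its singular line, which bounds `F`.
  set F : ℂ → ℂ := fun z => if h < z.im then cauchySq a b μ z else - g z with hF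
  have hF1 : ∀ z : ℂ, 0 < z.im → F z = cauchySq a b μ z := by
    intro z hz
    by_cases hzh : h < z.im
    · simp [hF, hzh]
    · have := hsum (x := z) ⟨hz, by simp at hzh ⊢; linarith⟩
      simp only [hF, hzh, if_false]
      exact (eq_neg_of_add_eq_zero_left this).symm
  have hF2 : ∀ z : ℂ, z.im < 2 * h → F z = - g z := by
    intro z hz
    by_cases hzh : h < z.im
    · have := hsum (x := z) ⟨hh.trans hzh, hz⟩
      simp only [hF, hzh, if_true]
      exact eq_neg_of_add_eq_zero_left this
    · simp [hF, hzh]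
  have hFd : Differentiable ℂ F := by
    intro z
    rcases lt_or_ge 0 z.im with hz | hz
    · refine (hfd z hz).congr_of_eventuallyEq ?_
      filter_upwards [(isOpen_lt continuous_const Complex.continuous_im).mem_nhds hz] with v hv
        using hF1 v hv
    · have hz' : z.im < 2 * h := by linarith
      refine (hgd z hz').neg.congr_of_eventuallyEq ?_
      filter_upwards [(isOpen_lt Complex.continuous_im continuous_const).mem_nhds hz'] with v hv
        using hF2 v hv
  have hFb : Bornology.IsBounded (range F) := by
    refine isBounded_iff_forall_norm_le.2
      ⟨max ((∫ t in Ioo a b, ‖μ t‖) / h ^ 2) ((∫ t in Ioo a b, ‖ν t‖) / h ^ 2), ?_⟩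
    rintro _ ⟨z, rfl⟩
    by_cases hzh : h < z.im
    · rw [hF1 z (hh.trans hzh)]
      exact (norm_cauchySq_le hμ hh (hzh.le.trans (le_abs_self _))).trans (le_max_left _ _)
    · rw [hF2 z (by linarith), norm_neg]
      refine (norm_cauchySq_le hν hh ?_).trans (le_max_right _ _)
      rw [imsub, abs_of_neg] <;> linarith
  obtain ⟨k, hk⟩ := hFd.exists_eq_const_of_bounded hFb
  -- The constant is evaluated along the positive imaginary axis, where the first integral tends to
  -- zero.
  have hk0 : k = 0 := by
    have hle : ∀ r : ℝ, 0 < r → ‖k‖ ≤ (∫ t in Ioo a b, ‖μ t‖) / r ^ 2 := by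
      intro r hr
      have h1 : F (r * Complex.I) = k := by rw [hk]; rfl
      rw [← h1, hF1 _ (by simpa using hr)]
      exact norm_cauchySq_le hμ hr (by simpa using le_abs_self r)
    have ht : Tendsto (fun r : ℝ => (∫ t in Ioo a b, ‖μ t‖) / r ^ 2) atTop (𝓝 0) :=
      tendsto_const_nhds.div_atTop (tendsto_pow_atTop two_ne_zero)
    exact norm_le_zero_iff.1
      (ge_of_tendsto ht ((eventually_gt_atTop 0).mono hle))
  refine ae_eq_zero_of_frequently_cauchySq_eq_zero hμ (z := x + h * Complex.I)
    (by simpa using hh.ne') (frequently_nhdsNE_add_mul_I hx fun s _ => ?_)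
  rw [← hF1 _ (by simpa using hh), hk, hk0]
  rfl

end NetMoment

/-! ### Minimization over a ball of a Hilbert space -/

namespace NetMoment

/-- A bounded linear operator attains its minimal distance to a point on a closed ball of a Hilbert
space. -/
theorem exists_isMinOn_norm_sub_closedBall {H E : Type*} [NormedAddCommGroup H]
    [InnerProductSpace ℝ H] [CompleteSpace H] [NormedAddCommGroup E] [InnerProductSpace ℝ E]
    [CompleteSpace E] (A : H →L[ℝ] E) (e : E) {M : ℝ} (hM : 0 ≤ M) :
    ∃ x, ‖x‖ ≤ M ∧ ∀ y, ‖y‖ ≤ M → ‖A x - e‖ ≤ ‖A y - e‖ := by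
  -- Riesz duality turns weak compactness of the ball of `H` into weak-* compactness, that is, the
  -- Banach–Alaoglu theorem. It remains to see that the objective is weak-* lower semicontinuous.
  set D := InnerProductSpace.toDual ℝ H
  set f : WeakDual ℝ H → ℝ :=
    fun l => ‖A (D.symm (WeakDual.toStrongDual l)) - e‖ with hf
  have hpair : ∀ (l : WeakDual ℝ H) (v : E),
      inner ℝ v (A (D.symm (WeakDual.toStrongDual l)) - e)
        = l (ContinuousLinearMap.adjoint A v) - inner ℝ v e := by
    intro l v
    rw [inner_sub_right, ← ContinuousLinearMap.adjoint_inner_left, real_inner_comm,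
      InnerProductSpace.toDual_symm_apply]
    rfl
  have hlsc : LowerSemicontinuous f := by
    rw [lowerSemicontinuous_iff_isClosed_preimage]
    intro r
    rcases lt_or_ge r 0 with hr | hr
    · have e0 : f ⁻¹' Iic r = ∅ :=
        eq_empty_of_forall_notMem fun l hl => ((norm_nonneg _).trans hl).not_gt hr
      rw [e0]
      exact isClosed_empty
    -- For `r ≥ 0`, `‖w‖ ≤ r` holds exactly when `⟨v, w⟩ ≤ ‖v‖ r` for all `v`, so the sublevel set
    -- is an intersection of weak-* closed half-spaces. The nontrivial direction takes `v = w`.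
    have e1 : f ⁻¹' Iic r
        = ⋂ v : E, {l | l (ContinuousLinearMap.adjoint A v) - inner ℝ v e ≤ ‖v‖ * r} := by
      ext l
      simp only [mem_preimage, mem_Iic, mem_iInter, mem_ofPred_eq, ← hpair]
      constructor
      · intro h v
        exact (real_inner_le_norm _ _).trans (mul_le_mul_of_nonneg_left h (norm_nonneg _))
      · intro h
        have h1 := h (A (D.symm (WeakDual.toStrongDual l)) - e)
        rw [real_inner_self_eq_norm_sq, sq] at h1
        rcases (norm_nonneg (A (D.symm (WeakDual.toStrongDual l)) - e)).eq_or_lt with h0 | h0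
        · exact h0.ge.trans hr
        · exact le_of_mul_le_mul_left h1 h0
    rw [e1]
    refine isClosed_iInter fun v => isClosed_le ?_ continuous_const
    exact (WeakDual.eval_continuous _).sub continuous_const
  obtain ⟨l, hl, hmin⟩ := hlsc.lowerSemicontinuousOn _ |>.exists_isMinOn
    (s := WeakDual.toStrongDual ⁻¹' Metric.closedBall (0 : StrongDual ℝ H) M)
    ⟨0, by simpa using hM⟩ (WeakDual.isCompact_closedBall (0 : StrongDual ℝ H) M)
  refine ⟨D.symm (WeakDual.toStrongDual l), by simpa using hl, fun y hy => ?_⟩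
  have := hmin (a := StrongDual.toWeakDual (D y)) (by simpa using hy)
  simpa [hf] using this

end NetMoment

namespace NetMoment

/-! ### Primitives of square integrable functions -/

theorem integrableOn_L2 {c d : ℝ} (g : L2 c d) : IntegrableOn g (Ioo c d) :=
  (Lp.memLp g).integrable (by norm_num)

theorem intervalIntegrable_L2 {c d : ℝ} (hcd : c ≤ d) (g : L2 c d) :
    IntervalIntegrable g volume c d :=
  (intervalIntegrable_iff_integrableOn_Ioo_of_le hcd).2 (integrableOn_L2 g)

theorem intervalIntegral_eq_setIntegral_Ioo {c d : ℝ} (hcd : c ≤ d) (f : ℝ → ℝ) :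
    ∫ t in c..d, f t = ∫ t in Ioo c d, f t := by
  rw [intervalIntegral.integral_of_le hcd, integral_Ioc_eq_integral_Ioo]

/-- The primitive of `g` vanishing at the left endpoint. -/
noncomputable def primitiveFun {c d : ℝ} (g : L2 c d) (x : ℝ) : ℝ := ∫ t in c..x, g t

theorem absolutelyContinuous_primitiveFun {c d : ℝ} (hcd : c ≤ d) (g : L2 c d) :
    AbsolutelyContinuousOnInterval (primitiveFun g) c d :=
  (intervalIntegrable_L2 hcd g).absolutelyContinuousOnInterval_intervalIntegral left_mem_uIcc

theorem continuousOn_primitiveFun {c d : ℝ} (hcd : c ≤ d) (g : L2 c d) :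
    ContinuousOn (primitiveFun g) (Icc c d) := by
  simpa [uIcc_of_le hcd] using (absolutelyContinuous_primitiveFun hcd g).continuousOn

theorem intervalIntegrable_L2_of_mem {c d x : ℝ} (hx : x ∈ Icc c d) (g : L2 c d) :
    IntervalIntegrable g volume c x :=
  (intervalIntegrable_L2 (hx.1.trans hx.2) g).mono_set
    (by rw [uIcc_of_le hx.1, uIcc_of_le (hx.1.trans hx.2)]; exact Icc_subset_Icc_right hx.2)

theorem integral_norm_L2_le {c d : ℝ} (g : L2 c d) :
    ∫ t in Ioo c d, ‖g t‖ ≤ (volume.restrict (Ioo c d)).real univ ^ (1 / 2 : ℝ) * ‖g‖ := by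
  have hm := Lp.memLp g
  have h1 : eLpNorm g 1 (volume.restrict (Ioo c d)) ≤
      eLpNorm g 2 (volume.restrict (Ioo c d)) *
        (volume.restrict (Ioo c d)) univ ^ (1 / (1 : ENNReal).toReal - 1 / (2 : ENNReal).toReal) :=
    eLpNorm_le_eLpNorm_mul_rpow_measure_univ (by norm_num) hm.1
  have hfin : eLpNorm g 2 (volume.restrict (Ioo c d)) *
      (volume.restrict (Ioo c d)) univ ^
        (1 / (1 : ENNReal).toReal - 1 / (2 : ENNReal).toReal) ≠ ⊤ :=
    ENNReal.mul_ne_top hm.2.ne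
      (ENNReal.rpow_ne_top_of_nonneg (by norm_num) (measure_ne_top _ _))
  have h2 := ENNReal.toReal_mono hfin h1
  rw [integral_norm_eq_lintegral_enorm hm.1, ← eLpNorm_one_eq_lintegral_enorm]
  refine h2.trans (le_of_eq ?_)
  rw [ENNReal.toReal_mul, ← ENNReal.toReal_rpow, Lp.norm_def, mul_comm, Measure.real]
  norm_num

theorem abs_primitiveFun_le {c d x : ℝ} (hx : x ∈ Ioo c d) (g : L2 c d) :
    |primitiveFun g x| ≤ (volume.restrict (Ioo c d)).real univ ^ (1 / 2 : ℝ) * ‖g‖ := by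
  refine le_trans ?_ (integral_norm_L2_le g)
  rw [primitiveFun, intervalIntegral_eq_setIntegral_Ioo hx.1.le, ← Real.norm_eq_abs]
  refine (norm_integral_le_integral_norm _).trans ?_
  exact setIntegral_mono_set (integrableOn_L2 g).norm (Eventually.of_forall fun _ => norm_nonneg _)
    (Ioo_subset_Ioo_right hx.2.le : Ioo c x ⊆ Ioo c d).eventuallyLE

theorem memLp_primitiveFun {c d : ℝ} (hcd : c ≤ d) (g : L2 c d) :
    MemLp (primitiveFun g) 2 (volume.restrict (Ioo c d)) :=
  MemLp.of_bound (((continuousOn_primitiveFun hcd g).mono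
    Ioo_subset_Icc_self).aestronglyMeasurable measurableSet_Ioo) _
    ((ae_restrict_iff' measurableSet_Ioo).2 (Eventually.of_forall fun _ hx =>
      abs_primitiveFun_le hx g))

theorem ae_uIoc_of_ae_Ioo {c d x : ℝ} (hx : x ∈ Icc c d) {p : ℝ → Prop}
    (h : ∀ᵐ t ∂volume.restrict (Ioo c d), p t) : ∀ᵐ t, t ∈ uIoc c x → p t := by
  have h1 : ∀ᵐ t ∂volume.restrict (Ioc c d), p t := by
    rwa [← Measure.restrict_congr_set Ioo_ae_eq_Ioc]
  rw [ae_restrict_iff' measurableSet_Ioc] at h1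
  filter_upwards [h1] with t ht htx
  rw [uIoc_of_le hx.1] at htx
  exact ht (Ioc_subset_Ioc_right hx.2 htx)

theorem primitiveFun_add {c d x : ℝ} (hx : x ∈ Icc c d) (f g : L2 c d) :
    primitiveFun (f + g) x = primitiveFun f x + primitiveFun g x := by
  rw [primitiveFun, primitiveFun, primitiveFun, ← intervalIntegral.integral_add
    (intervalIntegrable_L2_of_mem hx f) (intervalIntegrable_L2_of_mem hx g)]
  exact intervalIntegral.integral_congr_ae (ae_uIoc_of_ae_Ioo hx (Lp.coeFn_add f g))

theorem primitiveFun_smul {c d x : ℝ} (hx : x ∈ Icc c d) (r : ℝ) (g : L2 c d) :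
    primitiveFun (r • g) x = r * primitiveFun g x := by
  rw [primitiveFun, primitiveFun, ← intervalIntegral.integral_const_mul]
  exact intervalIntegral.integral_congr_ae (ae_uIoc_of_ae_Ioo hx (Lp.coeFn_smul r g))

/-- The operator sending `g ∈ L²((c, d))` to its primitive vanishing at `c`. -/
noncomputable def primitive {c d : ℝ} (hcd : c ≤ d) : L2 c d →L[ℝ] L2 c d :=
  LinearMap.mkContinuous
    { toFun := fun g => (memLp_primitiveFun hcd g).toLp (primitiveFun g)
      map_add' := fun f g => by
        rw [← MemLp.toLp_add]
        exact MemLp.toLp_congr _ _ ((ae_restrict_iff' measurableSet_Ioo).2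
          (Eventually.of_forall fun x hx => primitiveFun_add (Ioo_subset_Icc_self hx) f g))
      map_smul' := fun r g => by
        rw [RingHom.id_apply, ← MemLp.toLp_const_smul]
        exact MemLp.toLp_congr _ _ ((ae_restrict_iff' measurableSet_Ioo).2
          (Eventually.of_forall fun x hx => primitiveFun_smul (Ioo_subset_Icc_self hx) r g)) }
    ((measureUnivNNReal (volume.restrict (Ioo c d)) : ℝ) ^ (2 : ENNReal).toReal⁻¹ *
      (volume.restrict (Ioo c d)).real univ ^ (1 / 2 : ℝ))
    (fun g => by
      have hb := Lp.norm_le_of_ae_bound (p := 2)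
        (f := (memLp_primitiveFun hcd g).toLp (primitiveFun g))
        (C := (volume.restrict (Ioo c d)).real univ ^ (1 / 2 : ℝ) * ‖g‖) (by positivity) (by
          filter_upwards [(memLp_primitiveFun hcd g).coeFn_toLp,
            ae_restrict_mem measurableSet_Ioo] with x hx hxI
          rw [hx]
          exact abs_primitiveFun_le hxI g)
      exact hb.trans (le_of_eq (mul_assoc _ _ _).symm))

theorem primitive_coeFn {c d : ℝ} (hcd : c ≤ d) (g : L2 c d) :
    primitive hcd g =ᵐ[volume.restrict (Ioo c d)] primitiveFun g :=
  (memLp_primitiveFun hcd g).coeFn_toLp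

theorem eq_zero_of_notMem_Ioo {c d x : ℝ} {η : ℝ → ℝ} (hs : tsupport η ⊆ Ioo c d)
    (hx : x ∉ Ioo c d) : η x = 0 :=
  image_eq_zero_of_notMem_tsupport fun h => hx (hs h)

/-- The primitive is absolutely continuous with derivative `g` almost everywhere, so integration by
parts applies; the boundary terms vanish with the test function. -/
theorem isWeakDeriv_primitive {c d : ℝ} (hcd : c ≤ d) (g : L2 c d) :
    IsWeakDeriv (primitive hcd g) g := by
  intro η hη hc hs
  have hηac : AbsolutelyContinuousOnInterval η c d :=
    (hη.of_le (by simp)).contDiffOn.absolutelyContinuousOnInterval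
  have h1 := (absolutelyContinuous_primitiveFun hcd g).integral_mul_deriv_eq_deriv_mul hηac
  rw [eq_zero_of_notMem_Ioo hs (x := c) (by simp), eq_zero_of_notMem_Ioo hs (x := d) (by simp),
    mul_zero, mul_zero, sub_zero, zero_sub] at h1
  have h2 : ∫ x in c..d, deriv (primitiveFun g) x * η x = ∫ x in c..d, g x * η x := by
    refine intervalIntegral.integral_congr_ae ?_
    filter_upwards [(intervalIntegrable_L2 hcd g).ae_hasDerivAt_integral] with x hx hxI
    have := (hx (uIoc_subset_uIcc hxI) c left_mem_uIcc).deriv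
    rw [← this]
    rfl
  rw [h2, intervalIntegral_eq_setIntegral_Ioo hcd, intervalIntegral_eq_setIntegral_Ioo hcd] at h1
  rw [← h1]
  refine integral_congr_ae ?_
  filter_upwards [primitive_coeFn hcd g] with x hx
  rw [hx]

/-! ### Functions with vanishing weak derivative -/

theorem exists_Icc_superset_of_isCompact_of_subset_Ioo {c d : ℝ} (hcd : c < d) {K : Set ℝ}
    (hK : IsCompact K) (hs : K ⊆ Ioo c d) : ∃ p q, c < p ∧ q < d ∧ K ⊆ Icc p q := by
  rcases K.eq_empty_or_nonempty with rfl | hne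
  · obtain ⟨x, hx⟩ := exists_between hcd
    exact ⟨x, x, hx.1, hx.2, empty_subset _⟩
  · obtain ⟨p, hp⟩ := hK.exists_isLeast hne
    obtain ⟨q, hq⟩ := hK.exists_isGreatest hne
    exact ⟨p, q, (hs hp.1).1, (hs hq.1).2, fun x hx => ⟨hp.2 hx, hq.2 hx⟩⟩

/-- A test function on `(c, d)` with zero mean is the derivative of a test function. -/
theorem exists_primitive_of_integral_eq_zero {c d : ℝ} (hcd : c < d) {ρ : ℝ → ℝ}
    (hρ : ContDiff ℝ ∞ ρ) (hc : HasCompactSupport ρ) (hs : tsupport ρ ⊆ Ioo c d)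
    (h0 : ∫ x in Ioo c d, ρ x = 0) :
    ∃ η : ℝ → ℝ, ContDiff ℝ ∞ η ∧ HasCompactSupport η ∧ tsupport η ⊆ Ioo c d ∧ deriv η = ρ := by
  obtain ⟨p, q, hp, hq, hpq⟩ := exists_Icc_superset_of_isCompact_of_subset_Ioo hcd hc hs
  set η : ℝ → ℝ := fun x => ∫ t in c..x, ρ t with hη
  have hd : ∀ x, HasDerivAt η (ρ x) x := fun x =>
    intervalIntegral.integral_hasDerivAt_right (hρ.continuous.intervalIntegrable _ _)
      hρ.continuous.stronglyMeasurable.stronglyMeasurableAtFilter hρ.continuous.continuousAt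
  have hderiv : deriv η = ρ := funext fun x => (hd x).deriv
  have hz : ∀ x, x ∉ Icc p q → ρ x = 0 := fun x hx =>
    image_eq_zero_of_notMem_tsupport fun h => hx (hpq h)
  have hηs : Function.support η ⊆ Icc p q := by
    intro x hx
    by_contra hxI
    refine hx ?_
    rcases lt_or_ge x p with hxp | hxp
    · refine intervalIntegral.integral_zero_ae (Eventually.of_forall fun t ht => hz t fun h => ?_)
      have := (mem_uIoc.1 ht)
      rcases this with this | this <;> linarith [h.1, this.2]
    · have hxq : q < x := by
        by_contra hxq
        exact hxI ⟨hxp, not_lt.1 hxq⟩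
      -- Beyond `q` the primitive has collected the whole integral of `ρ`, which is zero.
      have e : η x = (∫ t in c..d, ρ t) + ∫ t in d..x, ρ t :=
        (intervalIntegral.integral_add_adjacent_intervals (hρ.continuous.intervalIntegrable _ _)
          (hρ.continuous.intervalIntegrable _ _)).symm
      rw [e, intervalIntegral_eq_setIntegral_Ioo hcd.le, h0, zero_add]
      refine intervalIntegral.integral_zero_ae (Eventually.of_forall fun t ht => hz t fun h => ?_)
      have := (mem_uIoc.1 ht)
      rcases this with this | this <;> linarith [h.2, this.1]
  refine ⟨η, contDiff_infty_iff_deriv.2 ⟨fun x => (hd x).differentiableAt, hderiv ▸ hρ⟩,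
    HasCompactSupport.intro (isCompact_Icc (a := p) (b := q)) fun x hx => ?_, ?_, hderiv⟩
  · by_contra h
    exact hx (hηs h)
  · exact (closure_minimal hηs isClosed_Icc).trans fun x hx =>
      ⟨hp.trans_le hx.1, hx.2.trans_lt hq⟩

theorem ae_eq_zero_of_forall_test {c d : ℝ} {f : ℝ → ℝ} (hf : IntegrableOn f (Ioo c d))
    (h : ∀ η : ℝ → ℝ, ContDiff ℝ ∞ η → HasCompactSupport η → tsupport η ⊆ Ioo c d →
      ∫ x in Ioo c d, f x * η x = 0) : f =ᵐ[volume.restrict (Ioo c d)] 0 := by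
  refine (ae_restrict_iff' measurableSet_Ioo).2
    (isOpen_Ioo.ae_eq_zero_of_integral_contDiff_smul_eq_zero hf.locallyIntegrableOn ?_)
  intro η hη hc hs
  rw [← setIntegral_eq_integral_of_forall_compl_eq_zero (s := Ioo c d), ← h η hη hc hs]
  · simp only [smul_eq_mul, mul_comm]
  · intro x hx
    simp [eq_zero_of_notMem_Ioo hs hx]

/-- Du Bois-Reymond's argument: with `ψ` a fixed bump of mass one, `ζ - (∫ ζ) ψ` has zero mean,
hence is the derivative of a test function and is annihilated by `f`. So `∫ f ζ = (∫ f ψ)(∫ ζ)`, and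
the constant is `∫ f ψ`. -/
theorem exists_ae_eq_const_of_isWeakDeriv_zero {c d : ℝ} (hcd : c < d) {f : L2 c d}
    (hf : IsWeakDeriv f 0) : ∃ k : ℝ, f =ᵐ[volume.restrict (Ioo c d)] fun _ => k := by
  let B : ContDiffBump ((c + d) / 2 : ℝ) :=
    ⟨(d - c) / 8, (d - c) / 4, by linarith, by linarith⟩
  set ψ : ℝ → ℝ := B.normed volume with hψ
  have hψd : ContDiff ℝ ∞ ψ := B.contDiff_normed
  have hψc : HasCompactSupport ψ := B.hasCompactSupport_normed
  have hψs : tsupport ψ ⊆ Ioo c d := by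
    rw [hψ, B.tsupport_normed_eq, Real.closedBall_eq_Icc]
    intro x hx
    have h1 : (c + d) / 2 - (d - c) / 4 ≤ x := hx.1
    have h2 : x ≤ (c + d) / 2 + (d - c) / 4 := hx.2
    constructor <;> linarith
  have hψ1 : ∫ x in Ioo c d, ψ x = 1 := by
    rw [setIntegral_eq_integral_of_forall_compl_eq_zero
      fun x hx => eq_zero_of_notMem_Ioo hψs hx]
    exact B.integral_normed
  set k := ∫ x in Ioo c d, f x * ψ x with hk
  refine ⟨k, ?_⟩
  have hz : (fun x => f x - k) =ᵐ[volume.restrict (Ioo c d)] 0 := by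
    refine ae_eq_zero_of_forall_test ((integrableOn_L2 f).sub (integrable_const k)) ?_
    intro ζ hζ hζc hζs
    have hint : ∀ {u : ℝ → ℝ}, Continuous u → HasCompactSupport u → IntegrableOn u (Ioo c d) :=
      fun h1 h2 => (h1.integrable_of_hasCompactSupport h2).integrableOn
    set s := ∫ x in Ioo c d, ζ x with hs
    obtain ⟨η, hη, hηc, hηs, hηd⟩ := exists_primitive_of_integral_eq_zero hcd
      (ρ := fun x => ζ x - s * ψ x) (hζ.sub (contDiff_const.mul hψd))
      (hζc.sub hψc.mul_left)
      ((tsupport_sub _ _).trans (union_subset hζs ((tsupport_mul_subset_right).trans hψs)))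
      (by
        rw [integral_sub (hint hζ.continuous hζc) ((hint hψd.continuous hψc).const_mul s),
          integral_const_mul, hψ1, ← hs]
        ring)
    have h1 := hf η hη hηc hηs
    have h2 : ∫ x in Ioo c d, (0 : L2 c d) x * η x = 0 := by
      refine integral_eq_zero_of_ae ?_
      filter_upwards [Lp.coeFn_zero ℝ 2 (volume.restrict (Ioo c d))] with x hx
      rw [hx]
      simp
    rw [h2, neg_zero, hηd] at h1
    have hfζ := integrable_mul_test f hζ.continuous hζc
    have hfψ := integrable_mul_test f hψd.continuous hψc
    have e1 : ∫ x in Ioo c d, f x * (ζ x - s * ψ x)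
        = (∫ x in Ioo c d, f x * ζ x) - s * k := by
      rw [hk, ← integral_const_mul, ← integral_sub hfζ (hfψ.const_mul s)]
      congr 1
      ext x
      ring
    have e2 : ∫ x in Ioo c d, (f x - k) * ζ x
        = (∫ x in Ioo c d, f x * ζ x) - k * s := by
      rw [hs, ← integral_const_mul, ← integral_sub hfζ ((hint hζ.continuous hζc).const_mul k)]
      congr 1
      ext x
      ring
    rw [e2, mul_comm k s, ← e1, h1]
  filter_upwards [hz] with x hx
  exact sub_eq_zero.1 hx

/-! ### The space `W_0^{1,2}` through primitives -/

theorem weakDeriv_eq {c d : ℝ} {f : W12 c d} {g : L2 c d} (h : IsWeakDeriv (f : L2 c d) g) :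
    weakDeriv f = g :=
  (weakDeriv_spec f).unique h

theorem weakDeriv_add {c d : ℝ} (f g : W12 c d) :
    weakDeriv (f + g) = weakDeriv f + weakDeriv g :=
  weakDeriv_eq ((weakDeriv_spec f).add (weakDeriv_spec g))

theorem weakDeriv_smul {c d : ℝ} (r : ℝ) (f : W12 c d) :
    weakDeriv (r • f) = r • weakDeriv f :=
  weakDeriv_eq ((weakDeriv_spec f).smul r)

theorem W012norm_add_le {c d : ℝ} (φ ψ : W012 c d) :
    W012norm (φ + ψ) ≤ W012norm φ + W012norm ψ := by
  simp only [W012norm, Submodule.coe_add, weakDeriv_add]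
  exact norm_add_le _ _

theorem W012norm_smul {c d : ℝ} (r : ℝ) (φ : W012 c d) :
    W012norm (r • φ) = |r| * W012norm φ := by
  simp only [W012norm, Submodule.coe_smul, weakDeriv_smul, norm_smul, Real.norm_eq_abs]

/-- The functional `g ↦ ∫ g` on `L²((c, d))`. -/
noncomputable def meanFunctional (c d : ℝ) : L2 c d →L[ℝ] ℝ :=
  innerSL ℝ (indicatorConstLp 2 MeasurableSet.univ
    (measure_ne_top (volume.restrict (Ioo c d)) univ) (1 : ℝ))

theorem meanFunctional_apply {c d : ℝ} (g : L2 c d) :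
    meanFunctional c d g = ∫ x in Ioo c d, g x := by
  rw [meanFunctional, innerSL_apply_apply, L2.inner_indicatorConstLp_one, Measure.restrict_univ]

/-- A primitive of a function of zero mean, as an element of `W_0^{1,2}`. -/
noncomputable def primitiveW {c d : ℝ} (hcd : c ≤ d) (g : L2 c d)
    (hg : meanFunctional c d g = 0) : W012 c d :=
  ⟨⟨primitive hcd g, g, isWeakDeriv_primitive hcd g⟩, primitiveFun g,
    continuousOn_primitiveFun hcd g, primitive_coeFn hcd g, intervalIntegral.integral_same, by
      rw [primitiveFun, intervalIntegral_eq_setIntegral_Ioo hcd, ← meanFunctional_apply, hg]⟩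

theorem W012norm_primitiveW {c d : ℝ} (hcd : c ≤ d) (g : L2 c d)
    (hg : meanFunctional c d g = 0) : W012norm (primitiveW hcd g hg) = ‖g‖ := by
  rw [W012norm, weakDeriv_eq (isWeakDeriv_primitive hcd g)]

/-- The function and the primitive of its weak derivative differ by a constant. Vanishing at `c`
makes the constant zero, and vanishing at `d` then says that the derivative has zero mean. -/
theorem coe_eq_primitive_weakDeriv {c d : ℝ} (hcd : c < d) (φ : W012 c d) :
    ((φ : W12 c d) : L2 c d) = primitive hcd.le (weakDeriv (φ : W12 c d)) ∧
      meanFunctional c d (weakDeriv (φ : W12 c d)) = 0 := by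
  set g := weakDeriv (φ : W12 c d) with hg
  set f : L2 c d := ((φ : W12 c d) : L2 c d) with hf
  obtain ⟨F, hF, hfF, hFc, hFd⟩ := φ.2
  have hw : IsWeakDeriv (f + (-1 : ℝ) • primitive hcd.le g) 0 := by
    have := (weakDeriv_spec (φ : W12 c d)).add ((isWeakDeriv_primitive hcd.le g).smul (-1))
    rwa [← hg, neg_one_smul ℝ g, add_neg_cancel] at this
  obtain ⟨k, hk⟩ := exists_ae_eq_const_of_isWeakDeriv_zero hcd hw
  have hae : F =ᵐ[volume.restrict (Ioo c d)] fun x => primitiveFun g x + k := by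
    filter_upwards [hk, hfF, Lp.coeFn_add f ((-1 : ℝ) • primitive hcd.le g),
      Lp.coeFn_smul (-1 : ℝ) (primitive hcd.le g), primitive_coeFn hcd.le g] with x h1 h2 h3 h4 h5
    rw [h3, Pi.add_apply, h4, Pi.smul_apply, h5, h2, smul_eq_mul] at h1
    linarith
  -- Continuity upgrades almost everywhere equality to equality on all of `[c, d]`, so that the
  -- endpoints may be evaluated.
  have heq : EqOn F (fun x => primitiveFun g x + k) (Icc c d) := by
    refine Measure.eqOn_of_ae_eq (μ := volume) ?_ hF
      ((continuousOn_primitiveFun hcd.le g).add continuousOn_const) ?_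
    · rwa [← Measure.restrict_congr_set Ioo_ae_eq_Icc]
    · rw [interior_Icc, closure_Ioo hcd.ne]
  have hk0 : k = 0 := by
    have := heq (left_mem_Icc.2 hcd.le)
    simpa [hFc, primitiveFun, eq_comm] using this
  constructor
  · refine Lp.ext ?_
    filter_upwards [hfF, hae, primitive_coeFn hcd.le g] with x h1 h2 h3
    rw [h1, h2, h3, hk0, add_zero]
  · have := heq (right_mem_Icc.2 hcd.le)
    simp only [hFd, hk0, add_zero] at this
    rw [primitiveFun, intervalIntegral_eq_setIntegral_Ioo hcd.le] at this
    rw [meanFunctional_apply, ← this]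

theorem exists_W012_ae_eq_test {c d : ℝ} (hcd : c < d) {η : ℝ → ℝ} (hη : ContDiff ℝ ∞ η)
    (hc : HasCompactSupport η) (hs : tsupport η ⊆ Ioo c d) :
    ∃ φ : W012 c d, ((φ : W12 c d) : L2 c d) =ᵐ[volume.restrict (Ioo c d)] η := by
  have hd : Continuous (deriv η) := hη.continuous_deriv (by simp)
  have hmem : ∀ {u : ℝ → ℝ}, Continuous u → HasCompactSupport u →
      MemLp u 2 (volume.restrict (Ioo c d)) := fun h1 h2 =>
    (h1.memLp_of_hasCompactSupport h2).restrict _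
  have hηL := hmem hη.continuous hc
  have hw : IsWeakDeriv (hηL.toLp η) ((hmem hd hc.deriv).toLp (deriv η)) := by
    intro ζ hζ hζc hζs
    have e1 : ∫ x in Ioo c d, hηL.toLp η x * deriv ζ x = ∫ x in c..d, η x * deriv ζ x := by
      rw [intervalIntegral_eq_setIntegral_Ioo hcd.le]
      refine integral_congr_ae ?_
      filter_upwards [hηL.coeFn_toLp] with x hx
      rw [hx]
    have e2 : ∫ x in Ioo c d, (hmem hd hc.deriv).toLp (deriv η) x * ζ x
        = ∫ x in c..d, deriv η x * ζ x := by
      rw [intervalIntegral_eq_setIntegral_Ioo hcd.le]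
      refine integral_congr_ae ?_
      filter_upwards [(hmem hd hc.deriv).coeFn_toLp] with x hx
      rw [hx]
    rw [e1, e2, AbsolutelyContinuousOnInterval.integral_mul_deriv_eq_deriv_mul
      (hη.of_le (by simp)).contDiffOn.absolutelyContinuousOnInterval
      (hζ.of_le (by simp)).contDiffOn.absolutelyContinuousOnInterval,
      eq_zero_of_notMem_Ioo hs (x := c) (by simp), eq_zero_of_notMem_Ioo hs (x := d) (by simp)]
    ring
  exact ⟨⟨⟨hηL.toLp η, _, hw⟩, η, hη.continuous.continuousOn, hηL.coeFn_toLp,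
    eq_zero_of_notMem_Ioo hs (by simp), eq_zero_of_notMem_Ioo hs (by simp)⟩, hηL.coeFn_toLp⟩

/-- `W_0^{1,2}` is dense in `L²`. -/
theorem eq_zero_of_forall_inner_W012_eq_zero {c d : ℝ} (hcd : c < d) {u : L2 c d}
    (h : ∀ φ : W012 c d, inner ℝ ((φ : W12 c d) : L2 c d) u = 0) : u = 0 := by
  refine Lp.ext ((ae_eq_zero_of_forall_test (integrableOn_L2 u) ?_).trans
    (Lp.coeFn_zero ℝ 2 _).symm)
  intro η hη hc hs
  obtain ⟨φ, hφ⟩ := exists_W012_ae_eq_test hcd hη hc hs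
  rw [← h φ, L2.inner_def]
  refine integral_congr_ae ?_
  filter_upwards [hφ] with x hx
  simp [hx]

end NetMoment

namespace NetMoment

/-! ### Injectivity of `b₂` and of its adjoint -/

/-- This is the `y`-derivative of `P_y(x) + i Q_y(x) = i / (π (x + iy))`. -/
theorem kernel_eq_inv_sq {h : ℝ} (hh : 0 < h) (s : ℝ) :
    ((dyP h s : ℂ) + dyQ h s * Complex.I) * Real.pi = 1 / ((s : ℂ) + h * Complex.I) ^ 2 := by
  have hpi : (Real.pi : ℂ) ≠ 0 := by exact_mod_cast Real.pi_ne_zero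
  have hn : ((s : ℂ) ^ 2 + (h : ℂ) ^ 2) ≠ 0 := by
    exact_mod_cast (by positivity : s ^ 2 + h ^ 2 ≠ 0)
  have hprod : ((s : ℂ) + h * Complex.I) * (s - h * Complex.I) = s ^ 2 + h ^ 2 := by
    linear_combination (-(h : ℂ) ^ 2) * Complex.I_sq
  have hz : ((s : ℂ) + h * Complex.I) ≠ 0 := fun h0 => hn (by rw [← hprod, h0, zero_mul])
  have hP : (dyP h s : ℂ) + dyQ h s * Complex.I
      = 1 / Real.pi * ((s - h * Complex.I) ^ 2 / (s ^ 2 + h ^ 2) ^ 2) := by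
    simp only [dyP, dyQ]
    push_cast
    field_simp
    linear_combination (-(h : ℂ) ^ 2) * Complex.I_sq
  rw [hP, ← hprod]
  have hz' : ((s : ℂ) - h * Complex.I) ≠ 0 := fun h0 => hn (by rw [← hprod, h0, mul_zero])
  field_simp

theorem integrable_kernel_mul_L2 {c d : ℝ} {k : ℝ → ℝ} (hk : Continuous k) {C : ℝ}
    (hC : ∀ x, |k x| ≤ C) (φ : L2 c d) (t : ℝ) :
    Integrable (fun x => k (x - t) * φ x) (volume.restrict (Ioo c d)) :=
  (integrableOn_L2 φ).bdd_mul (c := C) (hk.comp (by fun_prop)).aestronglyMeasurable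
    (Eventually.of_forall fun x => hC (x - t))

theorem continuous_integral_kernel_L2 {c d : ℝ} {k : ℝ → ℝ} (hk : Continuous k) {C : ℝ}
    (hC : ∀ x, |k x| ≤ C) (φ : L2 c d) :
    Continuous fun t => ∫ x in Ioo c d, k (x - t) * φ x := by
  refine continuous_of_dominated (bound := fun x => C * |φ x|)
    (fun t => (integrable_kernel_mul_L2 hk hC φ t).aestronglyMeasurable) ?_
    ((integrableOn_L2 φ).abs.const_mul C) ?_
  · intro t
    refine Eventually.of_forall fun x => ?_
    rw [Real.norm_eq_abs, abs_mul]
    exact mul_le_mul_of_nonneg_right (hC _) (abs_nonneg _)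
  · exact Eventually.of_forall fun x => by fun_prop

theorem integral_mul_integral_kernel {a b c d : ℝ} {k : ℝ → ℝ} (hk : Continuous k) {C : ℝ}
    (hC : ∀ x, |k x| ≤ C) (φ : L2 c d) (m : L2vec a b) (i : Fin 2) :
    ∫ x in Ioo c d, φ x * ∫ t in Ioo a b, k (x - t) * m t i
      = ∫ t in Ioo a b, (∫ x in Ioo c d, k (x - t) * φ x) * m t i := by
  have hint : Integrable (Function.uncurry fun x t => φ x * (k (x - t) * m t i))
      ((volume.restrict (Ioo c d)).prod (volume.restrict (Ioo a b))) := by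
    have h1 := ((integrableOn_L2 φ).mul_prod (integrable_comp m i)).bdd_mul (c := C)
      (f := fun p : ℝ × ℝ => k (p.1 - p.2)) (hk.comp (by fun_prop)).aestronglyMeasurable
      (Eventually.of_forall fun p => hC _)
    refine h1.congr (Eventually.of_forall fun p => ?_)
    simp only [Function.uncurry]
    ring
  simp_rw [← integral_const_mul, ← integral_mul_const]
  rw [integral_integral_swap hint]
  congr 1
  ext t
  congr 1
  ext x
  ring

/-- Fubini's theorem yields the adjoint in weak form: up to sign, the components of `b₂*φ` are the
integrals of `φ` against the two kernels. -/
theorem inner_b2_eq_integral {a b c d h : ℝ} (hh : 0 < h) (φ : L2 c d)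
    (m : L2vec a b) :
    inner ℝ φ (b2 a b c d hh m) = - ((∫ t in Ioo a b, (∫ x in Ioo c d, dyQ h (x - t) * φ x) * m t 0)
      + ∫ t in Ioo a b, (∫ x in Ioo c d, dyP h (x - t) * φ x) * m t 1) := by
  have hb : ∀ {k : ℝ → ℝ} (hk : Continuous k) {C : ℝ} (hC : ∀ x, |k x| ≤ C) (i : Fin 2),
      Integrable (fun x => φ x * ∫ t in Ioo a b, k (x - t) * m t i)
        (volume.restrict (Ioo c d)) := fun hk _ hC i =>
    (integrableOn_L2 φ).mul_bdd (continuous_integral_kernel hk hC m i).aestronglyMeasurable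
      (Eventually.of_forall fun x => abs_integral_kernel_le hC m i x)
  rw [← integral_mul_integral_kernel (continuous_dyQ hh) (abs_dyQ_le hh le_rfl),
    ← integral_mul_integral_kernel (continuous_dyP hh) (abs_dyP_le hh le_rfl),
    ← integral_add (hb (continuous_dyQ hh) (abs_dyQ_le hh le_rfl) 0)
      (hb (continuous_dyP hh) (abs_dyP_le hh le_rfl) 1), ← integral_neg, L2.inner_def]
  refine integral_congr_ae ?_
  filter_upwards [b2_coeFn a b c d hh m] with x hx
  rw [hx, fieldFun_eq hh]
  simp
  ring

/-- The two components vanish separately on `S`, so they combine into one complex integral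
`cauchySq` of `φ` that is zero on a segment of the line `Im z = -h`. -/
theorem eq_zero_of_b2star_eq_zero {a b c d h : ℝ} (hab : a < b) (hh : 0 < h) {φ : L2 c d}
    (hφ : b2star a b c d hh φ = 0) : φ = 0 := by
  set ψQ : ℝ → ℝ := fun t => ∫ x in Ioo c d, dyQ h (x - t) * φ x with hψQ
  set ψP : ℝ → ℝ := fun t => ∫ x in Ioo c d, dyP h (x - t) * φ x with hψP
  have hQc : Continuous ψQ :=
    continuous_integral_kernel_L2 (continuous_dyQ hh) (abs_dyQ_le hh le_rfl) φ
  have hPc : Continuous ψP :=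
    continuous_integral_kernel_L2 (continuous_dyP hh) (abs_dyP_le hh le_rfl) φ
  have horth : ∀ m : L2vec a b,
      (∫ t in Ioo a b, ψQ t * m t 0) + ∫ t in Ioo a b, ψP t * m t 1 = 0 := by
    intro m
    have h1 := inner_b2_eq_integral hh φ m
    rw [← ContinuousLinearMap.adjoint_inner_left] at h1
    rw [b2star] at hφ
    rw [hφ, inner_zero_left] at h1
    exact neg_eq_zero.1 h1.symm
  -- Fields `η • (r, s)` isolate each component by taking `(r, s)` to be a basis vector.
  have htest : ∀ (r s : ℝ) (η : ℝ → ℝ), Continuous η → HasCompactSupport η →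
      (∫ t in Ioo a b, ψQ t * (η t * r)) + ∫ t in Ioo a b, ψP t * (η t * s) = 0 := by
    intro r s η hη hc
    have hm : MemLp (fun t => η t • (!₂[r, s] : EuclideanSpace ℝ (Fin 2))) 2
        (volume.restrict (Ioo a b)) :=
      (Continuous.memLp_of_hasCompactSupport (by fun_prop) hc.smul_right).restrict _
    rw [← horth (hm.toLp _)]
    congr 1
    · refine integral_congr_ae ?_
      filter_upwards [hm.coeFn_toLp] with t ht
      rw [ht]
      simp
    · refine integral_congr_ae ?_
      filter_upwards [hm.coeFn_toLp] with t ht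
      rw [ht]
      simp
  have hzero : ∀ {ψ : ℝ → ℝ}, Continuous ψ → (∀ η : ℝ → ℝ, Continuous η → HasCompactSupport η →
      ∫ t in Ioo a b, ψ t * η t = 0) → EqOn ψ 0 (Ioo a b) := by
    intro ψ hψ h
    refine Measure.eqOn_open_of_ae_eq (μ := volume) ?_ isOpen_Ioo hψ.continuousOn
      continuousOn_const
    exact ae_eq_zero_of_forall_test
      ((hψ.integrableOn_Icc (a := a) (b := b)).mono_set Ioo_subset_Icc_self)
      fun η hη hc _ => h η hη.continuous hc
  have hQ0 := hzero hQc fun η hη hc => by simpa using htest 1 0 η hη hc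
  have hP0 := hzero hPc fun η hη hc => by simpa using htest 0 1 η hη hc
  have hφi : IntegrableOn (fun x => (φ x : ℂ)) (Ioo c d) := (integrableOn_L2 φ).ofReal
  obtain ⟨t₀, ht₀⟩ := exists_between hab
  have hae := ae_eq_zero_of_frequently_cauchySq_eq_zero hφi
    (z := t₀ + (-h : ℝ) * Complex.I) (by simpa using hh.ne')
    (frequently_nhdsNE_add_mul_I ht₀ fun t ht => ?_)
  · refine Lp.ext ?_
    filter_upwards [hae, Lp.coeFn_zero ℝ 2 (volume.restrict (Ioo c d))] with x hx h0
    rw [h0]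
    exact Complex.ofReal_eq_zero.1 hx
  · have hQi := integrable_kernel_mul_L2 (continuous_dyQ hh) (abs_dyQ_le hh le_rfl) φ t
    have hPi := integrable_kernel_mul_L2 (continuous_dyP hh) (abs_dyP_le hh le_rfl) φ t
    have e : cauchySq c d (fun x => (φ x : ℂ)) (t + (-h : ℝ) * Complex.I)
        = ((ψP t : ℂ) + ψQ t * Complex.I) * Real.pi := by
      simp only [hψP, hψQ]
      rw [cauchySq, ← integral_complex_ofReal, ← integral_complex_ofReal, ← integral_mul_const,
        ← integral_add hPi.ofReal (hQi.ofReal.mul_const _), ← integral_mul_const]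
      congr 1
      ext x
      have h1 := kernel_eq_inv_sq hh (x - t)
      have h2 : ((t : ℂ) + (-h : ℝ) * Complex.I - x) ^ 2 = (((x - t : ℝ) : ℂ) + h * Complex.I) ^ 2 := by
        push_cast
        ring
      rw [h2, div_eq_mul_one_div, ← h1]
      push_cast
      ring
    rw [e, hQ0 ht, hP0 ht]
    simp

theorem integrable_cauchySq_integrand {a b : ℝ} {μ : ℝ → ℂ} (hμ : IntegrableOn μ (Ioo a b)) {z : ℂ}
    (hz : z.im ≠ 0) :
    Integrable (fun t : ℝ => μ t / (z - t) ^ 2) (volume.restrict (Ioo a b)) := by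
  simp_rw [div_eq_mul_inv]
  refine hμ.mul_bdd (c := (|z.im| ^ 2)⁻¹)
    (Measurable.aestronglyMeasurable (by fun_prop)) (Eventually.of_forall fun t => ?_)
  rw [norm_inv, norm_pow]
  have h1 : |z.im| ≤ ‖z - t‖ := by simpa using Complex.abs_im_le_norm (z - t)
  have h2 : 0 < |z.im| := abs_pos.2 hz
  gcongr

/-- Here only one real equation is available. It equates to zero the sum of a complex integral and
its conjugate, and conjugation reflects the evaluation point to `x - ih = (x + ih) - 2ih`. -/
theorem eq_zero_of_b2_eq_zero {a b c d h : ℝ} (hcd : c < d) (hh : 0 < h) {m : L2vec a b}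
    (hm : b2 a b c d hh m = 0) : m = 0 := by
  have hfield : EqOn (fieldFun h m) 0 (Ioo c d) := by
    refine Measure.eqOn_open_of_ae_eq (μ := volume) ?_ isOpen_Ioo
      (continuous_fieldFun hh m).continuousOn continuousOn_const
    have h1 := b2_coeFn a b c d hh m
    rw [hm] at h1
    exact h1.symm.trans (Lp.coeFn_zero ℝ 2 _)
  -- With `μ = m₂ - i m₁` and `ν` its conjugate, the two integrands add up to `2π` times the real
  -- integrand of the field. Real and imaginary parts of `μ` recover `m`.
  set μ : ℝ → ℂ := fun t => (m t 1 : ℂ) - m t 0 * Complex.I with hμdef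
  set ν : ℝ → ℂ := fun t => (m t 1 : ℂ) + m t 0 * Complex.I with hνdef
  have h0i : IntegrableOn (fun t => (m t 0 : ℂ) * Complex.I) (Ioo a b) :=
    (integrable_comp m 0).ofReal.mul_const _
  have h1i : IntegrableOn (fun t => (m t 1 : ℂ)) (Ioo a b) := (integrable_comp m 1).ofReal
  have hμ : IntegrableOn μ (Ioo a b) := h1i.sub h0i
  have hν : IntegrableOn ν (Ioo a b) := h1i.add h0i
  have hae := ae_eq_zero_of_cauchySq_add_eq_zero hcd hh hμ hν fun x hx => ?_
  · refine Lp.ext ?_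
    filter_upwards [hae, Lp.coeFn_zero (EuclideanSpace ℝ (Fin 2)) 2
      (volume.restrict (Ioo a b))] with t ht h0
    rw [h0]
    have hre := congrArg Complex.re ht
    have him := congrArg Complex.im ht
    simp [hμdef] at hre him
    ext i
    fin_cases i
    · simpa using him
    · simpa using hre
  · have hf := hfield hx
    rw [Pi.zero_apply, fieldFun_eq hh, neg_eq_zero,
      ← integral_add (integrable_dyQ_mul hh m 0 x) (integrable_dyP_mul hh m 1 x)] at hf
    rw [cauchySq, cauchySq, ← integral_add
      (integrable_cauchySq_integrand hμ (by simpa using hh.ne'))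
      (integrable_cauchySq_integrand hν (by simp; linarith))]
    have e : ∀ t : ℝ, μ t / (x + h * Complex.I - t) ^ 2
        + ν t / (x + h * Complex.I - 2 * h * Complex.I - t) ^ 2
        = ((2 * Real.pi * (dyQ h (x - t) * m t 0 + dyP h (x - t) * m t 1) : ℝ) : ℂ) := by
      intro t
      have h1 := kernel_eq_inv_sq hh (x - t)
      have h2 : ((dyP h (x - t) : ℂ) - dyQ h (x - t) * Complex.I) * Real.pi
          = 1 / (((x - t : ℝ) : ℂ) - h * Complex.I) ^ 2 := by
        simpa [sub_eq_add_neg] using congrArg (starRingEnd ℂ) h1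
      have e1 : (x : ℂ) + h * Complex.I - t = ((x - t : ℝ) : ℂ) + h * Complex.I := by
        push_cast
        ring
      have e2 : (x : ℂ) + h * Complex.I - 2 * h * Complex.I - t
          = ((x - t : ℝ) : ℂ) - h * Complex.I := by
        push_cast
        ring
      rw [e1, e2, div_eq_mul_one_div, ← h1, div_eq_mul_one_div (ν t), ← h2]
      simp only [hμdef, hνdef]
      push_cast
      linear_combination (-2 * (m t 0 : ℂ) * dyQ h (x - t) * Real.pi) * Complex.I_sq
    simp_rw [e]
    rw [integral_complex_ofReal, integral_const_mul, hf]
    simp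

/-! ### The bounded extremal problem -/

theorem b2starW_add {a b c d h : ℝ} (hh : 0 < h) (φ ψ : W012 c d) :
    b2starW a b c d hh (φ + ψ) = b2starW a b c d hh φ + b2starW a b c d hh ψ :=
  map_add (b2star a b c d hh) _ _

theorem b2starW_smul {a b c d h : ℝ} (hh : 0 < h) (r : ℝ) (φ : W012 c d) :
    b2starW a b c d hh (r • φ) = r • b2starW a b c d hh φ :=
  map_smul (b2star a b c d hh) _ _

theorem b2starW_injective {a b c d h : ℝ} (hab : a < b) (hh : 0 < h) :
    Function.Injective (b2starW a b c d hh) := by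
  intro φ ψ hφψ
  have h1 : b2star a b c d hh (((φ : W12 c d) : L2 c d) - ((ψ : W12 c d) : L2 c d)) = 0 := by
    rw [map_sub]
    exact sub_eq_zero.2 hφψ
  exact Subtype.ext (Subtype.ext (sub_eq_zero.1 (eq_zero_of_b2star_eq_zero hab hh h1)))

theorem exists_isBEPSolution {a b c d h : ℝ} (hcd : c < d) (hh : 0 < h) (e : L2vec a b) {M : ℝ}
    (hM : 0 ≤ M) : ∃ φ : W012 c d, IsBEPSolution hh e M φ := by
  obtain ⟨g, hgM, hmin⟩ := exists_isMinOn_norm_sub_closedBall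
    ((b2star a b c d hh ∘L primitive hcd.le) ∘L (meanFunctional c d).ker.subtypeL) e hM
  refine ⟨primitiveW hcd.le g g.2, (W012norm_primitiveW hcd.le _ _).trans_le hgM, fun φ hφ => ?_⟩
  obtain ⟨h1, h2⟩ := coe_eq_primitive_weakDeriv hcd φ
  have h3 := hmin ⟨weakDeriv (φ : W12 c d), h2⟩ hφ
  simp only [mem_ofPred_eq, b2starW, h1]
  exact h3

/-- The midpoint of two solutions is admissible, so its residual is no shorter than theirs. Strict
convexity then forces the two residuals to coincide. -/
theorem IsBEPSolution.unique {a b c d h : ℝ} (hab : a < b) {hh : 0 < h} {e : L2vec a b} {M : ℝ}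
    {φ ψ : W012 c d} (hφ : IsBEPSolution hh e M φ) (hψ : IsBEPSolution hh e M ψ) : φ = ψ := by
  have hle : ‖b2starW a b c d hh φ - e‖ = ‖b2starW a b c d hh ψ - e‖ :=
    le_antisymm (hφ.2 hψ.1) (hψ.2 hφ.1)
  have hmid : W012norm ((1 / 2 : ℝ) • (φ + ψ)) ≤ M := by
    rw [W012norm_smul, abs_of_pos (by norm_num)]
    linarith [W012norm_add_le φ ψ, hφ.1, hψ.1]
  have h1 : ‖b2starW a b c d hh φ - e‖
      ≤ ‖b2starW a b c d hh ((1 / 2 : ℝ) • (φ + ψ)) - e‖ := hφ.2 hmid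
  have h2 : b2starW a b c d hh ((1 / 2 : ℝ) • (φ + ψ)) - e
      = (1 / 2 : ℝ) • ((b2starW a b c d hh φ - e) + (b2starW a b c d hh ψ - e)) := by
    rw [b2starW_smul, b2starW_add]
    module
  rw [h2, norm_smul, Real.norm_eq_abs, abs_of_pos (by norm_num)] at h1
  have h3 := eq_of_norm_eq_of_norm_add_eq hle
    (le_antisymm (norm_add_le _ _) (by linarith))
  exact b2starW_injective hab hh (sub_left_injective h3)

/-- The quadratic `‖u + s v‖² - ‖u‖²` has a local minimum at `s = 0`, where its derivative is `2⟨u,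
v⟩`. -/
theorem inner_eq_zero_of_norm_le_norm_add_smul {E : Type*} [NormedAddCommGroup E]
    [InnerProductSpace ℝ E] {u v : E} (h : ∀ᶠ s : ℝ in 𝓝 0, ‖u‖ ≤ ‖u + s • v‖) :
    inner ℝ u v = 0 := by
  have hd : HasDerivAt (fun s : ℝ => 2 * s * inner ℝ u v + s ^ 2 * ‖v‖ ^ 2)
      (2 * inner ℝ u v) 0 := by
    have h1 := (((hasDerivAt_id (0 : ℝ)).const_mul 2).mul_const (inner ℝ u v)).fun_add
      ((hasDerivAt_pow 2 (0 : ℝ)).mul_const (‖v‖ ^ 2))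
    simpa using h1
  have hmin : IsLocalMin (fun s : ℝ => 2 * s * inner ℝ u v + s ^ 2 * ‖v‖ ^ 2) 0 := by
    filter_upwards [h] with s hs
    have h1 : ‖u‖ ^ 2 ≤ ‖u + s • v‖ ^ 2 := by gcongr
    rw [norm_add_sq_real, inner_smul_right, norm_smul, mul_pow, Real.norm_eq_abs, sq_abs] at h1
    simp only [mul_zero, zero_mul, ne_eq, OfNat.ofNat_ne_zero, not_false_eq_true, zero_pow,
      add_zero]
    linarith
  linarith [hmin.hasDerivAt_eq_zero hd]

/-- If the constraint is not saturated at a solution, the data is attained exactly. -/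
theorem IsBEPSolution.b2starW_eq {a b c d h : ℝ} (hcd : c < d) {hh : 0 < h} {e : L2vec a b} {M : ℝ}
    {φ : W012 c d} (hφ : IsBEPSolution hh e M φ) (hlt : W012norm φ < M) :
    b2starW a b c d hh φ = e := by
  -- Since the constraint is slack, `φ + s ψ` is admissible for all small `s` of either sign.
  have horth : ∀ ψ : W012 c d,
      inner ℝ (b2starW a b c d hh φ - e) (b2starW a b c d hh ψ) = 0 := by
    intro ψ
    refine inner_eq_zero_of_norm_le_norm_add_smul ?_
    have ht : Tendsto (fun s : ℝ => W012norm φ + |s| * W012norm ψ) (𝓝 0) (𝓝 (W012norm φ)) := by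
      have : Continuous fun s : ℝ => W012norm φ + |s| * W012norm ψ := by fun_prop
      simpa using this.tendsto 0
    filter_upwards [ht.eventually (gt_mem_nhds hlt)] with s hs
    have h1 : W012norm (φ + s • ψ) ≤ M :=
      (W012norm_add_le _ _).trans ((W012norm_smul s ψ) ▸ hs.le)
    have h2 : ‖b2starW a b c d hh φ - e‖ ≤ ‖b2starW a b c d hh (φ + s • ψ) - e‖ := hφ.2 h1
    rwa [b2starW_add, b2starW_smul, add_sub_right_comm] at h2
  -- Passing to the adjoint, the orthogonality says that `b₂` of the residual is orthogonal to the
  -- dense subspace `W_0^{1,2}`.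
  have h1 : b2 a b c d hh (b2starW a b c d hh φ - e) = 0 := by
    refine eq_zero_of_forall_inner_W012_eq_zero hcd fun ψ => ?_
    rw [← ContinuousLinearMap.adjoint_inner_left, real_inner_comm]
    exact horth ψ
  exact sub_eq_zero.1 (eq_zero_of_b2_eq_zero hcd hh h1)

end NetMoment

theorem proposition4p3 (a b c d h : ℝ) (hS : a < b) (hK : c < d) (hh : 0 < h)
    (e : NetMoment.L2vec a b) (M : ℝ) (hM : 0 ≤ M) :
    (∃! φo : NetMoment.W012 c d, NetMoment.IsBEPSolution hh e M φo) ∧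
      (e ∉ Set.range (NetMoment.b2starW a b c d hh) →
        ∀ φo : NetMoment.W012 c d, NetMoment.IsBEPSolution hh e M φo →
          NetMoment.W012norm φo = M) := by
  obtain ⟨φ, hφ⟩ := NetMoment.exists_isBEPSolution hK hh e hM
  refine ⟨⟨φ, hφ, fun ψ hψ => hψ.unique hS hφ⟩, fun he ψ hψ => ?_⟩
  refine le_antisymm hψ.1 (not_lt.1 fun hlt => he ⟨ψ, hψ.b2starW_eq hK hlt⟩)
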